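/- **Setting.** Let $V=\{1,\dots,n\}$ be the vertex set of a simple undirected graph, and let $P\in\mathbb R^{n\times n}$ be a doubly stochastic matrix supported on the graph ($P_{vw}\ne 0$ only if $v=w$ or $\{v,w\}$ is an edge) with $PP^\top=P^\top P$ (for example, $P$ symmetric). Let $\sigma_2(P)$ be the second largest absolute value of an eigenvalue of $P$ (eigenvalues in $\mathbb C$, counted with algebraic multiplicity; $\sigma_2(P)=0$ if $n=1$), and assume $\sigma_2(P)<1$. Let $\|\cdot\|$ be the Euclidean norm on $\mathbb R^d$, and let $\ell:\mathbb R^d\times\mathcal Z\to\mathbb R$ be a loss such that for every $z\in\mathcal Z$ the function $\ell(\cdot,z)$ is convex, $L$-Lipschitz and $\beta$-smooth (differentiable with $\beta$-Lipschitz gradient), where $L,\beta>0$; for every $x$ the function $\ell(x,\cdot)$ is measurable and integrable with respect to a probability distribution $\mu$ on $\mathcal Z$. Node $v$ holds samples $Z_{v,1},\dots,Z_{v,m}$, and all the samples $Z_{v,i}$ are i.i.d. with law $\mu$. Put $$r(x)=\mathbf E_{Z\sim\mu}\,\ell(x,Z),\qquad R_v(x)=\frac1m\sum_{i=1}^m\ell(x,Z_{v,i}),\qquad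 R(x)=\frac1n\sum_{v\in V}R_v(x).$$ Assume that $r$ has a minimiser $x^\star$ and that, almost surely, $R$ has a minimiser $X^\star$ with $\|X^\star\|\le G$. Distributed SGD with step size $\eta$ is defined by $X^1_v=0$ for all $v\in V$ and, for $s\ge1$, $$X^{s+1}_v=\sum_{w\in V}P_{vw}\big(X^s_w-\eta\nabla\ell(X^s_w,Z_{w,K^{s+1}_w})\big),$$ where each $K^{s+1}_v$ is uniform on $\{1,\dots,m\}$, the vectors $(K^{s+1}_v)_{v\in V}$, $s\ge 1$, are independent, and they are jointly independent of the samples. Let $\sigma,\kappa>0$ be such that for all $v\in V$ and $s\ge1$ $$\mathbf E\big\|\nabla\ell(X^s_v,Z_{v,K^{s+1}_v})-\nabla R_v(X^s_v)\big\|^2\le\sigma^2,\qquad \mathbf E\Big\|\nabla\ell(X^s_v,Z_{v,K^{s+1}_v})-\frac1n\sum_{w\in V}\nabla R_w(X^s_w)\Big\|^2\le\kappa^2 .$$ **Theorem (test error bound for convex, Lipschitz and smooth losses).** Let $\rho>0$ and $\eta=1/(\beta+1/\rho)$, with $\eta\beta\le2$. Then for every $v\in V$ and $t\ge1$ the random variable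 $r\big(\frac1t\sum_{s=1}^tX^{s+1}_v\big)$ is integrable and $$\mathbf E\,r\Big(\frac1t\sum_{s=1}^tX^{s+1}_v\Big)-r(x^\star)\le\frac{L^2}{nm(\beta+1/\rho)}(t+1)+\frac\rho2\sigma^2+\frac{(\beta+1/\rho)G^2}{2t}+\frac{3\kappa}{\beta+1/\rho}\,\frac{\log((t+1)\sqrt n)}{1-\sigma_2(P)}\Big(L+\frac32\,\frac{\beta(3+\beta\rho)\kappa}{\beta+1/\rho}\,\frac{\log((t+1)\sqrt n)}{1-\sigma_2(P)}\Big).$$ -/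

import Mathlib

open MeasureTheory ProbabilityTheory

noncomputable section

/-- The space of models `ℝ^d` with the `ℓ₂` norm. -/
abbrev Model (d : ℕ) : Type := EuclideanSpace ℝ (Fin d)

/-- `f` is `β`-smooth: differentiable with `β`-Lipschitz gradient. -/
def IsSmoothWith {d : ℕ} (β : ℝ) (f : Model d → ℝ) : Prop :=
  Differentiable ℝ f ∧ ∀ x y, ‖gradient f x - gradient f y‖ ≤ β * ‖x - y‖

/-- `f` is `L`-Lipschitz. -/
def IsLipschitzWith {d : ℕ} (L : ℝ) (f : Model d → ℝ) : Prop :=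
  ∀ x y, |f x - f y| ≤ L * ‖x - y‖

/-- The absolute value of the second largest eigenvalue in absolute value of a real square
matrix: the moduli of the complex eigenvalues, listed with algebraic multiplicity in decreasing
order, and the second entry of that list (`0` if the matrix has size at most one). -/
def secondEigenvalueModulus {n : ℕ} (P : Matrix (Fin n) (Fin n) ℝ) : ℝ :=
  ((((P.map (algebraMap ℝ ℂ)).charpoly.roots.map (fun z : ℂ => ‖z‖)).sort
    (fun a b => b ≤ a)).getD 1 0)

/-- `P` is supported on the graph `G`: its nonzero off-diagonal entries sit on edges. -/
def SupportedOn {n : ℕ} (P : Matrix (Fin n) (Fin n) ℝ) (G : SimpleGraph (Fin n)) : Prop :=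
  ∀ v w, P v w ≠ 0 → v = w ∨ G.Adj v w

section Risk

variable {d n m : ℕ} {Z : Type*}

/-- The gradient `∇ℓ(x, z)` of the loss with respect to the model. -/
def lossGrad (loss : Model d → Z → ℝ) (x : Model d) (z : Z) : Model d :=
  gradient (fun y => loss y z) x

/-- The test risk `r(x) = 𝐄 ℓ(x, Z)` for `Z` of law `μ`. -/
def testRisk [MeasurableSpace Z] (loss : Model d → Z → ℝ) (μ : Measure Z) (x : Model d) : ℝ :=
  ∫ z, loss x z ∂μ

/-- The local empirical risk `R_v` for the dataset `D`, where `D v i` is the `i`-th sample of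
node `v`. -/
def localRisk (loss : Model d → Z → ℝ) (D : Fin n → Fin m → Z) (v : Fin n) (x : Model d) : ℝ :=
  (1 / (m : ℝ)) * ∑ i, loss x (D v i)

/-- The global empirical risk `R`. -/
def empiricalRisk (loss : Model d → Z → ℝ) (D : Fin n → Fin m → Z) (x : Model d) : ℝ :=
  (1 / (n : ℝ)) * ∑ v, localRisk loss D v x

/-- Distributed SGD. The value at `k` is the iterate `X^{k+1}` (so the value at `0` is the initial
vector `X^1 = x₀`), and `K k w` is the sample index `K_w^{k+2}` that node `w` uses to pass from
`X^{k+1}` to `X^{k+2}`. -/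
def distSGD (loss : Model d → Z → ℝ) (P : Matrix (Fin n) (Fin n) ℝ) (η : ℝ)
    (x₀ : Fin n → Model d) (D : Fin n → Fin m → Z) (K : ℕ → Fin n → Fin m) :
    ℕ → Fin n → Model d
  | 0 => x₀
  | k + 1 => fun v => ∑ w, P v w •
      (distSGD loss P η x₀ D K k w
        - η • lossGrad loss (distSGD loss P η x₀ D K k w) (D w (K k w)))

/-- The ergodic average `(1/t) ∑_{s=1}^t X_v^{s+1}`. -/
def ergodicAverage (loss : Model d → Z → ℝ) (P : Matrix (Fin n) (Fin n) ℝ) (η : ℝ)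
    (x₀ : Fin n → Model d) (D : Fin n → Fin m → Z) (K : ℕ → Fin n → Fin m)
    (t : ℕ) (v : Fin n) : Model d :=
  (1 / (t : ℝ)) • ∑ s ∈ Finset.Icc 1 t, distSGD loss P η x₀ D K s v

end Risk

/-- The probabilistic model: the training data `D v i` are i.i.d. with law `μ`; each sample index
`K k v` is uniform; the index vectors `(K k v)_v` are independent over time `k`; and the data are
independent of the indices. (No condition is put on the joint law of the indices of different
nodes at one and the same time.) -/
structure IsSamplingModel {Ω Z : Type*} [MeasurableSpace Ω] [MeasurableSpace Z] {n m : ℕ}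
    (Pr : Measure Ω) (μ : Measure Z) (D : Ω → Fin n → Fin m → Z) (K : Ω → ℕ → Fin n → Fin m) :
    Prop where
  measurable_data : ∀ v i, Measurable (fun ω => D ω v i)
  measurable_index : ∀ k v, Measurable (fun ω => K ω k v)
  law_data : ∀ v i, Pr.map (fun ω => D ω v i) = μ
  indep_data : iIndepFun (fun (p : Fin n × Fin m) ω => D ω p.1 p.2) Pr
  uniform_index : ∀ k v i, Pr.real {ω | K ω k v = i} = 1 / (m : ℝ)
  indep_index : iIndepFun (fun (k : ℕ) ω => K ω k) Pr
  indep_data_index : IndepFun D K Pr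

end

/-!
The expected excess test risk of the ergodic average `A` of distributed SGD splits into a
generalisation error `𝐄 [r(A) - R(A)]` and an optimisation error `𝐄 [R(A) - R(x⋆)]`, both of which
involve only differences of losses and hence bounded random variables.

*Generalisation.* Exchanging a sample with a fresh one expresses the generalisation error through
the effect on `A` of replacing one sample (`IsSamplingModel.integral_sub_sampleMean_le`). Gradient
steps on convex smooth losses are nonexpansive (`IsSmoothWith.norm_gradient_step_sub_le`), averaging
with a stochastic matrix is too, and in each round a node uses exactly one of its samples. So the
effects, summed over all samples, grow by at most `2 η L` per round, whatever the sample indices are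
(`IsRegularLoss.sum_norm_distSGD_replaceSample_le`).

*Optimisation.* As `P` is doubly stochastic, the network average of the iterates performs gradient
descent with an averaged gradient that is noisy and evaluated at the local iterates. The three-point
inequality `IsSmoothWith.sub_le_inner`, used locally at each node, turns the second defect into the
variance of the local iterates; the step size `1 / (β + 1 / ρ)` absorbs the squared displacements
(`IsRegularLoss.empiricalRisk_meanIterate_succ_sub_le`). The noise enters through inner products
with the averaged iterate minus the minimiser. These have mean zero for each fixed data set, and
comparing expectations data set by data set avoids any measurability of the minimiser
(`IsSamplingModel.integral_optimisation_error_le`).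

*Disagreement.* The distance of an iterate to the network average is a sum of centred gradients
weighted by `(P ^ j) v w - 1 / n`. For normal `P` the operator norm of `P` minus the averaging
matrix is its spectral radius, and its eigenvalues are those of `P` with one eigenvalue `1` replaced
by `0` (`roots_charpoly_sub_averagingMatrix`). Hence the weights decay geometrically, and their
total is at most `3 log ((t + 1) √n) / (1 - σ₂)` (`sum_sum_abs_pow_sub_le`).
-/

/-! ### Convex smooth functions -/

section ConvexSmooth

variable {d : ℕ} {f : Model d → ℝ} {L β : ℝ}

open scoped RealInnerProductSpace

lemma hasDerivAt_comp_lineMap (hf : Differentiable ℝ f) (x y : Model d) (s : ℝ) :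
    HasDerivAt (fun s : ℝ => f (x + s • (y - x))) ⟪gradient f (x + s • (y - x)), y - x⟫ s := by
  have h1 := (hf (x + s • (y - x))).hasGradientAt.hasFDerivAt
  have h2 : HasDerivAt (fun s : ℝ => x + s • (y - x)) (y - x) s := by
    simpa using ((hasDerivAt_id s).smul_const (y - x)).const_add x
  rw [inner_gradient_left]
  rw [toDual_gradient] at h1
  exact h1.comp_hasDerivAt s h2

lemma norm_gradient_le_of_isLipschitzWith (hL : 0 ≤ L) (hf : IsLipschitzWith L f) (x : Model d) :
    ‖gradient f x‖ ≤ L := by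
  have hlip : LipschitzWith L.toNNReal f := LipschitzWith.of_dist_le_mul fun a b => by
    simpa [Real.coe_toNNReal _ hL, dist_eq_norm] using hf a b
  have := norm_fderiv_le_of_lipschitz ℝ hlip (x₀ := x)
  rwa [← toDual_gradient, LinearIsometryEquiv.norm_map, Real.coe_toNNReal _ hL] at this

lemma ConvexOn.inner_gradient_le (hc : ConvexOn ℝ Set.univ f) (hf : Differentiable ℝ f)
    (x y : Model d) : ⟪gradient f x, y - x⟫ ≤ f y - f x := by
  have hg : ConvexOn ℝ Set.univ (fun s : ℝ => f (x + s • (y - x))) := by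
    have := hc.comp_affineMap (AffineMap.lineMap x y)
    simpa [Function.comp_def, AffineMap.lineMap_apply, add_comm] using this
  have hd := hasDerivAt_comp_lineMap hf x y 0
  have := hg.le_slope_of_hasDerivAt (Set.mem_univ 0) (Set.mem_univ 1) one_pos hd
  simpa [slope] using this

/-- The descent lemma: a `β`-smooth function lies below its quadratic upper model. -/
lemma IsSmoothWith.le_quadratic (hf : IsSmoothWith β f) (x y : Model d) :
    f y ≤ f x + ⟪gradient f x, y - x⟫ + β / 2 * ‖y - x‖ ^ 2 := by
  let φ : ℝ → ℝ := fun s => f (x + s • (y - x)) - s * ⟪gradient f x, y - x⟫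
    - s ^ 2 * (β / 2 * ‖y - x‖ ^ 2)
  have hφ : ∀ s, HasDerivAt φ (⟪gradient f (x + s • (y - x)), y - x⟫
      - ⟪gradient f x, y - x⟫ - 2 * s * (β / 2 * ‖y - x‖ ^ 2)) s := fun s => by
    have h1 := hasDerivAt_comp_lineMap hf.1 x y s
    have h2 := (hasDerivAt_id s).mul_const ⟪gradient f x, y - x⟫
    have h3 := (hasDerivAt_pow 2 s).mul_const (β / 2 * ‖y - x‖ ^ 2)
    convert! (h1.sub h2).sub h3 using 1
    simp
  have hanti : AntitoneOn φ (Set.Icc 0 1) := by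
    refine antitoneOn_of_deriv_nonpos (convex_Icc 0 1)
      (fun s _ => (hφ s).continuousAt.continuousWithinAt)
      (fun s _ => (hφ s).differentiableAt.differentiableWithinAt) fun s hs => ?_
    rw [interior_Icc] at hs
    rw [(hφ s).deriv, ← inner_sub_left]
    have h1 := real_inner_le_norm (gradient f (x + s • (y - x)) - gradient f x) (y - x)
    have h2 := hf.2 (x + s • (y - x)) x
    rw [add_sub_cancel_left, norm_smul, Real.norm_of_nonneg hs.1.le] at h2
    have h3 := mul_le_mul_of_nonneg_right h2 (norm_nonneg (y - x))
    nlinarith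
  have := hanti (Set.left_mem_Icc.2 zero_le_one) (Set.right_mem_Icc.2 zero_le_one) zero_le_one
  simp only [φ, one_smul, zero_smul, add_zero, add_sub_cancel] at this
  linarith

/-- The three-point inequality for convex smooth functions: the gradient at `x` controls the
difference of the values at two other points, up to the smoothness error at the first of them. -/
lemma IsSmoothWith.sub_le_inner (hf : IsSmoothWith β f) (hc : ConvexOn ℝ Set.univ f)
    (x y z : Model d) :
    f y - f z ≤ ⟪gradient f x, y - z⟫ + β / 2 * ‖y - x‖ ^ 2 := by
  have h1 := hf.le_quadratic x y
  have h2 := hc.inner_gradient_le hf.1 x z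
  have h3 : ⟪gradient f x, y - z⟫ = ⟪gradient f x, y - x⟫ - ⟪gradient f x, z - x⟫ := by
    rw [← inner_sub_right]; congr 1; abel
  linarith

/-- Cocoercivity of the gradient of a convex `β`-smooth function (Baillon–Haddad). -/
lemma IsSmoothWith.norm_sub_sq_le (hβ : 0 < β) (hf : IsSmoothWith β f)
    (hc : ConvexOn ℝ Set.univ f) (x y : Model d) :
    ‖gradient f x - gradient f y‖ ^ 2 ≤ β * ⟪gradient f x - gradient f y, x - y⟫ := by
  -- the tilted function `f - ⟪∇f b, ·⟫` is minimal at `b`; compare with its value after a gradient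
  -- step of length `1 / β` from `a`
  have key : ∀ a b : Model d, 1 / (2 * β) * ‖gradient f a - gradient f b‖ ^ 2 ≤
      f a - f b - ⟪gradient f b, a - b⟫ := fun a b => by
    set g := gradient f a - gradient f b with hg
    have h' := hc.inner_gradient_le hf.1 b (a - (1 / β) • g)
    have h1 := hf.le_quadratic a (a - (1 / β) • g)
    have e1 : a - (1 / β) • g - b = (a - b) - (1 / β) • g := by abel
    have e2 : a - (1 / β) • g - a = -((1 / β) • g) := by abel
    have e3 : ⟪gradient f a, g⟫ - ⟪gradient f b, g⟫ = ‖g‖ ^ 2 := by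
      rw [← inner_sub_left, ← hg, real_inner_self_eq_norm_sq]
    rw [e1, inner_sub_right, inner_smul_right] at h'
    rw [e2, inner_neg_right, inner_smul_right, norm_neg, norm_smul, mul_pow,
      Real.norm_of_nonneg (by positivity)] at h1
    have e4 : β / 2 * ((1 / β) ^ 2 * ‖g‖ ^ 2) = 1 / (2 * β) * ‖g‖ ^ 2 := by field_simp
    have e5 : 1 / β * ⟪gradient f a, g⟫ - 1 / β * ⟪gradient f b, g⟫ =
        2 * (1 / (2 * β) * ‖g‖ ^ 2) := by rw [← mul_sub, e3]; field_simp
    linarith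
  have h1 := key x y
  have h2 := key y x
  rw [norm_sub_rev] at h2
  have e : ⟪gradient f x - gradient f y, x - y⟫ =
      -⟪gradient f x, y - x⟫ - ⟪gradient f y, x - y⟫ := by
    rw [inner_sub_left, ← neg_sub x y, inner_neg_right, neg_neg]
  have h3 : 1 / β * ‖gradient f x - gradient f y‖ ^ 2 ≤
      ⟪gradient f x - gradient f y, x - y⟫ := by
    have : 1 / β = 1 / (2 * β) + 1 / (2 * β) := by field_simp; norm_num
    rw [e, this, add_mul]; linarith
  calc ‖gradient f x - gradient f y‖ ^ 2
      = β * (1 / β * ‖gradient f x - gradient f y‖ ^ 2) := by field_simp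
    _ ≤ _ := by gcongr

/-- A gradient step of size at most `2 / β` on a convex `β`-smooth function is nonexpansive. -/
lemma IsSmoothWith.norm_gradient_step_sub_le (hβ : 0 < β) (hf : IsSmoothWith β f)
    (hc : ConvexOn ℝ Set.univ f) {η : ℝ} (hη : 0 ≤ η) (hηβ : η * β ≤ 2) (x y : Model d) :
    ‖(x - η • gradient f x) - (y - η • gradient f y)‖ ≤ ‖x - y‖ := by
  have h := hf.norm_sub_sq_le hβ hc x y
  set g := gradient f x - gradient f y with hg
  have e : (x - η • gradient f x) - (y - η • gradient f y) = (x - y) - η • g := by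
    rw [hg, smul_sub]; abel
  rw [e]
  refine (sq_le_sq₀ (norm_nonneg _) (norm_nonneg _)).1 ?_
  rw [norm_sub_sq_real, inner_smul_right, real_inner_comm, norm_smul, mul_pow,
    Real.norm_of_nonneg hη]
  have h0 : 0 ≤ ⟪g, x - y⟫ := by
    by_contra hneg
    nlinarith [sq_nonneg ‖g‖, not_le.1 hneg]
  have h1 : η ^ 2 * ‖g‖ ^ 2 ≤ η * (2 * ⟪g, x - y⟫) := by
    calc η ^ 2 * ‖g‖ ^ 2 ≤ η ^ 2 * (β * ⟪g, x - y⟫) := by gcongr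
      _ = η * ((η * β) * ⟪g, x - y⟫) := by ring
      _ ≤ _ := by gcongr
  linarith

end ConvexSmooth

/-! ### Mixing of doubly stochastic matrices -/

section Spectral

open Polynomial

/-- If a multiset contains `a` and `b`, the second entry of its decreasing listing is at least
`min a b`. -/
lemma min_le_getD_one_sort {S : Multiset ℝ} {a b : ℝ} (h : {a, b} ≤ S) :
    min a b ≤ (S.sort (fun x y => y ≤ x)).getD 1 0 := by
  have hsort := S.pairwise_sort (fun x y : ℝ => y ≤ x)
  have hS : ((S.sort (fun x y : ℝ => y ≤ x) : List ℝ) : Multiset ℝ) = S := S.sort_eq _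
  generalize S.sort (fun x y : ℝ => y ≤ x) = l at hsort hS
  subst hS
  have hcard := Multiset.card_le_card h
  match l, hsort, hcard with
  | [], _, hc => simp at hc
  | [x], _, hc => simp at hc
  | x :: y :: l, hs, _ =>
    simp only [List.getD_cons_succ, List.getD_cons_zero]
    by_contra! hlt
    have h1 := Multiset.countP_le_of_le (fun z => y < z) h
    have h2 : Multiset.countP (fun z => y < z) ({a, b} : Multiset ℝ) = 2 := by
      have ha := hlt.trans_le (min_le_left a b)
      have hb := hlt.trans_le (min_le_right a b)
      rw [Multiset.insert_eq_cons, Multiset.countP_cons_of_pos _ ha,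
        ← Multiset.cons_zero b, Multiset.countP_cons_of_pos _ hb]
      simp
    have h3 : List.countP (fun z => decide (y < z)) l = 0 := by
      rw [List.countP_eq_zero]
      intro z hz
      simpa using (List.pairwise_cons.1 (List.pairwise_cons.1 hs).2).1 z hz
    rw [h2, Multiset.coe_countP, List.countP_cons, List.countP_cons, h3] at h1
    simp only [lt_self_iff_false, decide_false] at h1
    split_ifs at h1 <;> simp_all

/-- The averaging matrix, all of whose entries are `1 / n`. -/
noncomputable def averagingMatrix (n : ℕ) : Matrix (Fin n) (Fin n) ℝ :=
  Matrix.of fun _ _ => 1 / (n : ℝ)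

variable {n : ℕ} {P : Matrix (Fin n) (Fin n) ℝ}

lemma mul_averagingMatrix (hP : P ∈ doublyStochastic ℝ (Fin n)) :
    P * averagingMatrix n = averagingMatrix n := by
  ext i j
  simp [Matrix.mul_apply, averagingMatrix, ← Finset.sum_mul, sum_row_of_mem_doublyStochastic hP i]

lemma averagingMatrix_mul (hP : P ∈ doublyStochastic ℝ (Fin n)) :
    averagingMatrix n * P = averagingMatrix n := by
  ext i j
  simp [Matrix.mul_apply, averagingMatrix, ← Finset.mul_sum, sum_col_of_mem_doublyStochastic hP j]

lemma averagingMatrix_mul_self : averagingMatrix n * averagingMatrix n = averagingMatrix n := by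
  ext i j
  have : (n : ℝ) ≠ 0 := by have := i.pos; positivity
  simp [Matrix.mul_apply, averagingMatrix, this]

lemma averagingMatrix_transpose : (averagingMatrix n).transpose = averagingMatrix n := by
  ext i j; simp [averagingMatrix]

lemma sub_averagingMatrix_pow_succ (hP : P ∈ doublyStochastic ℝ (Fin n)) (j : ℕ) :
    (P - averagingMatrix n) ^ (j + 1) = P ^ (j + 1) - averagingMatrix n := by
  induction j with
  | zero => simp
  | succ j ih =>
    rw [pow_succ, ih, sub_mul, mul_sub, mul_sub, averagingMatrix_mul hP,
      averagingMatrix_mul_self, mul_averagingMatrix (pow_mem hP _), ← pow_succ]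
    abel

/-- Removing the averaging matrix from a doubly stochastic matrix replaces the eigenvalue `1` of
the constant vectors by `0` and leaves the other eigenvalues alone, with multiplicity. -/
lemma roots_charpoly_sub_averagingMatrix (hn : 0 < n) (hP : P ∈ doublyStochastic ℝ (Fin n)) :
    (1 : ℂ) ::ₘ ((P - averagingMatrix n).map (algebraMap ℝ ℂ)).charpoly.roots =
      0 ::ₘ (P.map (algebraMap ℝ ℂ)).charpoly.roots := by
  have hJ : (averagingMatrix n).charpoly = X ^ (n - 1) * (X - 1) := by
    have e : averagingMatrix n = Matrix.vecMulVec (fun _ => 1) (fun _ => 1 / (n : ℝ)) := by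
      ext i j; simp [averagingMatrix, Matrix.vecMulVec_apply]
    have hn' : (n : ℝ) ≠ 0 := by positivity
    rw [e, Matrix.charpoly_vecMulVec]
    have : X ^ n = (X : ℝ[X]) ^ (n - 1) * X := by rw [← pow_succ, Nat.sub_add_cancel hn]
    simp [dotProduct, hn', this, mul_sub]
  have hmul : Matrix.charmatrix (P - averagingMatrix n) * Matrix.charmatrix (averagingMatrix n) =
      (X : ℝ[X]) • Matrix.charmatrix P := by
    have h0 : (P - averagingMatrix n) * averagingMatrix n = 0 := by
      rw [sub_mul, mul_averagingMatrix hP, averagingMatrix_mul_self, sub_self]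
    have h1 : (C : ℝ →+* ℝ[X]).mapMatrix (P - averagingMatrix n) *
        (C : ℝ →+* ℝ[X]).mapMatrix (averagingMatrix n) = 0 := by
      rw [← map_mul, h0, map_zero]
    have h2 : ∀ M : Matrix (Fin n) (Fin n) ℝ[X], Matrix.scalar (Fin n) (X : ℝ[X]) * M = X • M :=
      fun M => by rw [Matrix.scalar_apply, Matrix.smul_eq_diagonal_mul]
    have h3 : ∀ M : Matrix (Fin n) (Fin n) ℝ[X], M * Matrix.scalar (Fin n) (X : ℝ[X]) = X • M :=
      fun M => by rw [← h2]; exact (Matrix.scalar_commute _ (fun r => Commute.all _ r) M).symm.eq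
    simp only [Matrix.charmatrix]
    rw [sub_mul, mul_sub, mul_sub, h1, h2, h2, h3, ← smul_sub, sub_zero, ← smul_sub, sub_sub,
      ← map_add, add_sub_cancel]
  have hdet := congrArg Matrix.det hmul
  rw [Matrix.det_mul, Matrix.det_smul, Fintype.card_fin] at hdet
  change (P - averagingMatrix n).charpoly * (averagingMatrix n).charpoly =
    X ^ n * P.charpoly at hdet
  rw [hJ] at hdet
  have hdet' : (X - C 1) * (P - averagingMatrix n).charpoly = X * P.charpoly := by
    have hX : (X : ℝ[X]) ^ (n - 1) ≠ 0 := pow_ne_zero _ X_ne_zero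
    have : X ^ n = (X : ℝ[X]) ^ (n - 1) * X := by rw [← pow_succ, Nat.sub_add_cancel hn]
    apply mul_left_cancel₀ hX
    rw [← mul_assoc _ X, ← this, ← hdet, C_1]; ring
  have hC := congrArg (fun p => (p.map (algebraMap ℝ ℂ)).roots) hdet'
  simp only [Polynomial.map_mul, Polynomial.map_sub, map_X,
    ← Matrix.charpoly_map] at hC
  rw [Polynomial.map_C, map_one] at hC
  rw [roots_mul (mul_ne_zero (X_sub_C_ne_zero _) (Matrix.charpoly_monic _).ne_zero),
    roots_mul (mul_ne_zero X_ne_zero (Matrix.charpoly_monic _).ne_zero), roots_X_sub_C,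
    roots_X] at hC
  simpa using hC

lemma secondEigenvalueModulus_nonneg : 0 ≤ secondEigenvalueModulus P := by
  unfold secondEigenvalueModulus
  set l := ((P.map (algebraMap ℝ ℂ)).charpoly.roots.map (fun z : ℂ => ‖z‖)).sort
    (fun a b => b ≤ a) with hl
  rw [List.getD_eq_getElem?_getD]
  cases h : l[1]? with
  | none => simp
  | some x =>
    have hx : x ∈ l := List.mem_of_getElem? h
    rw [hl, Multiset.mem_sort, Multiset.mem_map] at hx
    obtain ⟨z, -, rfl⟩ := hx
    simp

/-- Since the second eigenvalue modulus is below `1`, the eigenvalue `1` is the only one above it,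
and every eigenvalue that is left after removing the averaging matrix is bounded by it. -/
lemma norm_le_secondEigenvalueModulus (hn : 0 < n) (hP : P ∈ doublyStochastic ℝ (Fin n))
    (hgap : secondEigenvalueModulus P < 1) {z : ℂ}
    (hz : z ∈ ((P - averagingMatrix n).map (algebraMap ℝ ℂ)).charpoly.roots) :
    ‖z‖ ≤ secondEigenvalueModulus P := by
  by_cases hz0 : z = 0
  · simpa [hz0] using secondEigenvalueModulus_nonneg
  have h1 : {1, z} ≤ (0 : ℂ) ::ₘ (P.map (algebraMap ℝ ℂ)).charpoly.roots := by
    rw [← roots_charpoly_sub_averagingMatrix hn hP, Multiset.insert_eq_cons]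
    exact Multiset.cons_le_cons _ (Multiset.singleton_le.2 hz)
  have h2 : {1, z} ≤ (P.map (algebraMap ℝ ℂ)).charpoly.roots :=
    (Multiset.le_cons_of_notMem (by simp [eq_comm, hz0])).1 h1
  have h3 := Multiset.map_le_map (f := fun z : ℂ => ‖z‖) h2
  have h4 : min 1 ‖z‖ ≤ secondEigenvalueModulus P :=
    min_le_getD_one_sort (by simpa [Multiset.insert_eq_cons] using h3)
  rcases min_le_iff.1 h4 with h | h
  · exact absurd hgap (not_lt.2 h)
  · exact h

open scoped Matrix.Norms.L2Operator in
lemma sum_row_norm_sq_le_opNorm_sq (A : Matrix (Fin n) (Fin n) ℂ) (v : Fin n) :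
    ∑ w, ‖A v w‖ ^ 2 ≤ ‖A‖ ^ 2 := by
  have h := A.conjTranspose.l2_opNorm_mulVec (EuclideanSpace.single v (1 : ℂ))
  rw [Matrix.l2_opNorm_conjTranspose] at h
  have h2 := pow_le_pow_left₀ (norm_nonneg _) h 2
  rw [EuclideanSpace.norm_sq_eq] at h2
  simpa using h2

open scoped Matrix.Norms.L2Operator in
lemma opNorm_sub_averagingMatrix_le (hn : 0 < n) (hP : P ∈ doublyStochastic ℝ (Fin n))
    (hnormal : P * P.transpose = P.transpose * P) (hgap : secondEigenvalueModulus P < 1) :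
    ‖(P - averagingMatrix n).map (algebraMap ℝ ℂ)‖ ≤ secondEigenvalueModulus P := by
  set Q := P - averagingMatrix n with hQ
  have hPT : P.transpose ∈ doublyStochastic ℝ (Fin n) := transpose_mem_doublyStochastic_iff.2 hP
  have hQn : Q.transpose * Q = Q * Q.transpose := by
    rw [hQ, Matrix.transpose_sub, averagingMatrix_transpose]
    simp only [sub_mul, mul_sub, averagingMatrix_mul hP, averagingMatrix_mul hPT,
      mul_averagingMatrix hP, mul_averagingMatrix hPT, hnormal]
  have hstar : star (Q.map (algebraMap ℝ ℂ)) = Q.transpose.map (algebraMap ℝ ℂ) := by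
    ext i j; simp [Matrix.star_apply]
  have hnorm : IsStarNormal (Q.map (algebraMap ℝ ℂ)) := ⟨by
    rw [hstar, Commute, SemiconjBy, ← Matrix.map_mul, ← Matrix.map_mul, hQn]⟩
  have h := IsStarNormal.spectralRadius_eq_nnnorm (Q.map (algebraMap ℝ ℂ))
  have h2 : spectralRadius ℂ (Q.map (algebraMap ℝ ℂ)) ≤
      ((secondEigenvalueModulus P).toNNReal : ENNReal) := by
    refine iSup₂_le fun z hz => ?_
    rw [Matrix.mem_spectrum_iff_isRoot_charpoly] at hz
    have := norm_le_secondEigenvalueModulus hn hP hgap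
      ((mem_roots (Matrix.charpoly_monic _).ne_zero).2 hz)
    rw [ENNReal.coe_le_coe]
    exact NNReal.le_toNNReal_of_coe_le this
  rw [h, ENNReal.coe_le_coe] at h2
  have := NNReal.coe_le_coe.2 h2
  rwa [Real.coe_toNNReal _ secondEigenvalueModulus_nonneg] at this

/-- The rows of the powers of a doubly stochastic matrix approach the uniform distribution in
`ℓ¹`, at the geometric rate given by the second eigenvalue. Normality of the matrix enters here: it
makes the operator norm of `P - averagingMatrix n` equal to its spectral radius. -/
lemma sum_abs_pow_sub_le_geometric (hP : P ∈ doublyStochastic ℝ (Fin n))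
    (hnormal : P * P.transpose = P.transpose * P) (hgap : secondEigenvalueModulus P < 1)
    (v : Fin n) (j : ℕ) :
    ∑ w, |(P ^ (j + 1)) v w - 1 / (n : ℝ)| ≤ √(n : ℝ) * secondEigenvalueModulus P ^ (j + 1) := by
  open scoped Matrix.Norms.L2Operator in
  have h1 := sum_row_norm_sq_le_opNorm_sq
    (((P - averagingMatrix n).map (algebraMap ℝ ℂ)) ^ (j + 1)) v
  have h2 : ‖((P - averagingMatrix n).map (algebraMap ℝ ℂ)) ^ (j + 1)‖ ≤
      secondEigenvalueModulus P ^ (j + 1) :=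
    (norm_pow_le' _ j.succ_pos).trans
      (pow_le_pow_left₀ (norm_nonneg _) (opNorm_sub_averagingMatrix_le v.pos hP hnormal hgap) _)
  have h3 : ∑ w, |(P ^ (j + 1)) v w - 1 / (n : ℝ)| ^ 2 ≤
      (secondEigenvalueModulus P ^ (j + 1)) ^ 2 := by
    refine le_trans (le_of_eq ?_) (h1.trans (pow_le_pow_left₀ (norm_nonneg _) h2 2))
    refine Finset.sum_congr rfl fun w _ => ?_
    have e : ((P - averagingMatrix n).map (algebraMap ℝ ℂ)) ^ (j + 1) =
        ((P - averagingMatrix n) ^ (j + 1)).map (algebraMap ℝ ℂ) :=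
      (map_pow (algebraMap ℝ ℂ).mapMatrix (P - averagingMatrix n) (j + 1)).symm
    rw [e, sub_averagingMatrix_pow_succ hP, Matrix.map_apply, Complex.coe_algebraMap,
      Complex.norm_real, Real.norm_eq_abs]
    simp [averagingMatrix]
  have h4 := sq_sum_le_card_mul_sum_sq (s := Finset.univ)
    (f := fun w => |(P ^ (j + 1)) v w - 1 / (n : ℝ)|)
  rw [Finset.card_univ, Fintype.card_fin] at h4
  refine (sq_le_sq₀ (Finset.sum_nonneg fun _ _ => abs_nonneg _)
    (mul_nonneg (Real.sqrt_nonneg _) (pow_nonneg secondEigenvalueModulus_nonneg _))).1 ?_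
  rw [mul_pow, Real.sq_sqrt n.cast_nonneg]
  exact h4.trans (mul_le_mul_of_nonneg_left h3 n.cast_nonneg)

lemma sum_abs_pow_sub_le_two (hP : P ∈ doublyStochastic ℝ (Fin n)) (v : Fin n) (j : ℕ) :
    ∑ w, |(P ^ j) v w - 1 / (n : ℝ)| ≤ 2 := by
  have hn : (n : ℝ) ≠ 0 := by have := v.pos; positivity
  calc ∑ w, |(P ^ j) v w - 1 / (n : ℝ)|
      ≤ ∑ w, ((P ^ j) v w + 1 / (n : ℝ)) := by
        refine Finset.sum_le_sum fun w _ => (abs_sub _ _).trans (le_of_eq ?_)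
        rw [abs_of_nonneg (nonneg_of_mem_doublyStochastic (pow_mem hP j)),
          abs_of_nonneg (by positivity)]
    _ = 2 := by
        rw [Finset.sum_add_distrib, sum_row_of_mem_doublyStochastic (pow_mem hP j)]
        simp [hn]; norm_num

/-- The total deviation of the rows of `P, P², …, Pˢ` from uniform is logarithmic in the horizon and
inversely proportional to the spectral gap: up to the mixing time each power contributes at most
`2`, and beyond it the geometric bounds sum to at most `1`. -/
lemma sum_sum_abs_pow_sub_le (hP : P ∈ doublyStochastic ℝ (Fin n))
    (hnormal : P * P.transpose = P.transpose * P) (hgap : secondEigenvalueModulus P < 1)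
    (v : Fin n) {s t : ℕ} (ht : 1 ≤ t) (hst : s ≤ t) :
    ∑ j ∈ Finset.range s, ∑ w, |(P ^ (j + 1)) v w - 1 / (n : ℝ)| ≤
      3 * (Real.log (((t : ℝ) + 1) * √(n : ℝ)) / (1 - secondEigenvalueModulus P)) := by
  set lam := secondEigenvalueModulus P with hlam
  have hlam0 : 0 ≤ lam := secondEigenvalueModulus_nonneg
  have hgap' : 0 < 1 - lam := by linarith
  have hn : 1 ≤ n := v.pos
  have hsqrt : 1 ≤ √(n : ℝ) := Real.one_le_sqrt.2 (by exact_mod_cast hn)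
  have ht' : (1 : ℝ) ≤ t := by exact_mod_cast ht
  have hT : 0 < ((t : ℝ) + 1) * √(n : ℝ) := by positivity
  set x := Real.log (((t : ℝ) + 1) * √(n : ℝ)) / (1 - lam) with hx
  have hlog : 0 ≤ Real.log (((t : ℝ) + 1) * √(n : ℝ)) := Real.log_nonneg (by nlinarith)
  have hx0 : 0 ≤ x := div_nonneg hlog hgap'.le
  -- for a single node the powers are uniform already; for more nodes the logarithm exceeds `1`
  rcases hn.eq_or_lt with hn1 | hn2
  · subst hn1
    have : ∀ j, ∑ w, |(P ^ (j + 1)) v w - 1 / ((1 : ℕ) : ℝ)| = 0 := fun j => by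
      have h := sum_row_of_mem_doublyStochastic (pow_mem hP (j + 1)) v
      rw [Fin.sum_univ_one] at h ⊢
      simp [h]
    simp only [this, Finset.sum_const_zero]
    positivity
  have hx1 : 1 ≤ x := by
    rw [hx, le_div_iff₀ hgap', one_mul]
    have h2 : Real.exp 1 ≤ ((t : ℝ) + 1) * √(n : ℝ) := by
      have h3 : (1.4 : ℝ) ≤ √(n : ℝ) := by
        apply Real.le_sqrt_of_sq_le
        have : (2 : ℝ) ≤ n := by exact_mod_cast hn2
        norm_num; linarith
      have := Real.exp_one_lt_d9
      nlinarith
    have h4 := (Real.le_log_iff_exp_le hT).2 h2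
    linarith
  have hterm : ∀ j ∈ Finset.range s, ∑ w, |(P ^ (j + 1)) v w - 1 / (n : ℝ)| ≤
      (if j < ⌊x⌋₊ then 2 else 0) + 1 / ((t : ℝ) + 1) := fun j _ => by
    split_ifs with hj
    · have := sum_abs_pow_sub_le_two hP v (j + 1)
      have : 0 ≤ 1 / ((t : ℝ) + 1) := by positivity
      linarith
    · rw [zero_add]
      have hxj : x ≤ ((j + 1 : ℕ) : ℝ) :=
        (Nat.lt_of_floor_lt (Nat.lt_succ_of_le (not_lt.1 hj))).le
      refine (sum_abs_pow_sub_le_geometric hP hnormal hgap v j).trans ?_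
      have h1 : lam ^ (j + 1) ≤ 1 / (((t : ℝ) + 1) * √(n : ℝ)) := by
        calc lam ^ (j + 1) ≤ Real.exp (-(1 - lam)) ^ (j + 1) :=
              pow_le_pow_left₀ hlam0 (by have := Real.add_one_le_exp (-(1 - lam)); linarith) _
          _ = Real.exp (-(((j + 1 : ℕ) : ℝ) * (1 - lam))) := by
              rw [← Real.exp_nat_mul]; congr 1; ring
          _ ≤ Real.exp (-Real.log (((t : ℝ) + 1) * √(n : ℝ))) := by
              apply Real.exp_le_exp.2
              have := (div_le_iff₀ hgap').1 hxj
              linarith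
          _ = _ := by rw [Real.exp_neg, Real.exp_log hT, one_div]
      calc √(n : ℝ) * lam ^ (j + 1) ≤ √(n : ℝ) * (1 / (((t : ℝ) + 1) * √(n : ℝ))) := by gcongr
        _ = 1 / ((t : ℝ) + 1) := by field_simp
  refine (Finset.sum_le_sum hterm).trans ?_
  rw [Finset.sum_add_distrib, ← Finset.sum_filter, Finset.sum_const, Finset.sum_const,
    Finset.card_range, nsmul_eq_mul, nsmul_eq_mul]
  have h1 : (((Finset.range s).filter (· < ⌊x⌋₊)).card : ℝ) ≤ x := by
    refine le_trans ?_ (Nat.floor_le hx0)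
    have : (Finset.range s).filter (· < ⌊x⌋₊) ⊆ Finset.range ⌊x⌋₊ := fun j hj => by
      simpa using (Finset.mem_filter.1 hj).2
    exact_mod_cast (Finset.card_le_card this).trans_eq (Finset.card_range _)
  have h2 : (s : ℝ) * (1 / ((t : ℝ) + 1)) ≤ 1 := by
    rw [mul_one_div, div_le_one (by positivity)]
    have : (s : ℝ) ≤ t := by exact_mod_cast hst
    linarith
  linarith

end Spectral

/-! ### Regular losses -/

section Algorithm

open scoped RealInnerProductSpace

/-- The standing assumptions on the loss: for every data point it is convex, `L`-Lipschitz and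
`β`-smooth in the model. -/
structure IsRegularLoss {d : ℕ} {Z : Type*} (L β : ℝ) (loss : Model d → Z → ℝ) : Prop where
  L_nonneg : 0 ≤ L
  β_pos : 0 < β
  convex : ∀ z, ConvexOn ℝ Set.univ (fun x => loss x z)
  lipschitz : ∀ z, IsLipschitzWith L (fun x => loss x z)
  smooth : ∀ z, IsSmoothWith β (fun x => loss x z)

variable {d n m : ℕ} {Z : Type*} {loss : Model d → Z → ℝ} {L β : ℝ}

lemma IsRegularLoss.norm_lossGrad_le (h : IsRegularLoss L β loss) (x : Model d) (z : Z) :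
    ‖lossGrad loss x z‖ ≤ L :=
  norm_gradient_le_of_isLipschitzWith h.L_nonneg (h.lipschitz z) x

lemma IsRegularLoss.gradient_localRisk (h : IsRegularLoss L β loss) (D : Fin n → Fin m → Z)
    (v : Fin n) (x : Model d) :
    gradient (localRisk loss D v) x = (1 / (m : ℝ)) • ∑ i, lossGrad loss x (D v i) := by
  have h1 : HasFDerivAt (localRisk loss D v)
      ((1 / (m : ℝ)) • ∑ i, fderiv ℝ (fun y => loss y (D v i)) x) x := by
    have := HasFDerivAt.fun_sum (u := Finset.univ)
      fun i _ => ((h.smooth (D v i)).1 x).hasFDerivAt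
    exact this.const_mul (1 / (m : ℝ))
  rw [gradient, h1.fderiv, map_smul, map_sum]
  rfl

lemma IsRegularLoss.norm_gradient_localRisk_le (h : IsRegularLoss L β loss)
    (D : Fin n → Fin m → Z) (v : Fin n) (x : Model d) :
    ‖gradient (localRisk loss D v) x‖ ≤ L := by
  rw [h.gradient_localRisk, norm_smul, Real.norm_of_nonneg (by positivity)]
  have h1 : ‖∑ i, lossGrad loss x (D v i)‖ ≤ m * L :=
    (norm_sum_le_of_le _ fun i _ => h.norm_lossGrad_le x (D v i)).trans (by simp)
  rcases Nat.eq_zero_or_pos m with hm | hm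
  · subst hm; simpa using h.L_nonneg
  · calc 1 / (m : ℝ) * ‖∑ i, lossGrad loss x (D v i)‖ ≤ 1 / (m : ℝ) * (m * L) := by gcongr
      _ = L := by field_simp

/-! ### Stability of the iterates -/

/-- The data set `D` with the sample of index `i = (node, position)` replaced by `z`. -/
def replaceSample (D : Fin n → Fin m → Z) (i : Fin n × Fin m) (z : Z) : Fin n → Fin m → Z :=
  Function.update D i.1 (Function.update (D i.1) i.2 z)

lemma replaceSample_of_ne (D : Fin n → Fin m → Z) {i : Fin n × Fin m} (z : Z) {w : Fin n}
    {k : Fin m} (h : i ≠ (w, k)) : replaceSample D i z w k = D w k := by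
  unfold replaceSample
  by_cases hw : w = i.1
  · subst hw
    have : k ≠ i.2 := fun hk => h (by rw [hk])
    simp [this]
  · simp [hw]

/-- A gradient step is nonexpansive unless it uses the replaced sample, in which case the two
gradients differ by at most `2 * L`. -/
lemma IsRegularLoss.norm_step_sub_step_le (h : IsRegularLoss L β loss) {η : ℝ} (hη : 0 ≤ η)
    (hηβ : η * β ≤ 2) (D : Fin n → Fin m → Z) (i : Fin n × Fin m) (z : Z) (w : Fin n) (k : Fin m)
    (x y : Model d) :
    ‖(x - η • lossGrad loss x (D w k)) - (y - η • lossGrad loss y (replaceSample D i z w k))‖ ≤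
      ‖x - y‖ + if i = (w, k) then 2 * η * L else 0 := by
  have h1 : ‖(x - η • lossGrad loss x (D w k)) - (y - η • lossGrad loss y (D w k))‖ ≤ ‖x - y‖ :=
    (h.smooth (D w k)).norm_gradient_step_sub_le h.β_pos (h.convex _) hη hηβ x y
  split_ifs with hi
  · set z' := replaceSample D i z w k
    have e : (x - η • lossGrad loss x (D w k)) - (y - η • lossGrad loss y z') =
        ((x - η • lossGrad loss x (D w k)) - (y - η • lossGrad loss y (D w k))) +
          η • (lossGrad loss y z' - lossGrad loss y (D w k)) := by
      rw [smul_sub]; abel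
    rw [e]
    refine (norm_add_le _ _).trans (add_le_add h1 ?_)
    rw [norm_smul, Real.norm_of_nonneg hη]
    have h2 := norm_sub_le (lossGrad loss y z') (lossGrad loss y (D w k))
    have h3 := h.norm_lossGrad_le y z'
    have h4 := h.norm_lossGrad_le y (D w k)
    calc η * ‖lossGrad loss y z' - lossGrad loss y (D w k)‖ ≤ η * (L + L) := by gcongr; linarith
      _ = 2 * η * L := by ring
  · rw [replaceSample_of_ne D z hi, add_zero]
    exact h1

variable {P : Matrix (Fin n) (Fin n) ℝ} {η : ℝ}

lemma distSGD_succ (x₀ : Fin n → Model d) (D : Fin n → Fin m → Z) (K : ℕ → Fin n → Fin m)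
    (k : ℕ) (v : Fin n) :
    distSGD loss P η x₀ D K (k + 1) v = ∑ w, P v w • (distSGD loss P η x₀ D K k w
      - η • lossGrad loss (distSGD loss P η x₀ D K k w) (D w (K k w))) := rfl

/-- Stability summed over all positions of the replaced sample. In each round exactly one position
per node is sampled, so the bound holds for every realisation of the sample indices. -/
lemma IsRegularLoss.sum_norm_distSGD_replaceSample_le (h : IsRegularLoss L β loss)
    (hP : P ∈ doublyStochastic ℝ (Fin n)) (hη : 0 ≤ η) (hηβ : η * β ≤ 2) (x₀ : Fin n → Model d)
    (D : Fin n → Fin m → Z) (z : Z) (K : ℕ → Fin n → Fin m) (k : ℕ) (v : Fin n) :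
    ∑ i, ‖distSGD loss P η x₀ D K k v - distSGD loss P η x₀ (replaceSample D i z) K k v‖ ≤
      2 * η * L * k := by
  induction k generalizing v with
  | zero => simp [distSGD]
  | succ k ih =>
    calc ∑ i, ‖distSGD loss P η x₀ D K (k + 1) v
          - distSGD loss P η x₀ (replaceSample D i z) K (k + 1) v‖
        ≤ ∑ i, ∑ w, P v w * (‖distSGD loss P η x₀ D K k w
            - distSGD loss P η x₀ (replaceSample D i z) K k w‖
            + if i = (w, K k w) then 2 * η * L else 0) := by
          refine Finset.sum_le_sum fun i _ => ?_
          rw [distSGD_succ, distSGD_succ, ← Finset.sum_sub_distrib]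
          refine norm_sum_le_of_le _ fun w _ => ?_
          rw [← smul_sub, norm_smul, Real.norm_of_nonneg (nonneg_of_mem_doublyStochastic hP)]
          exact mul_le_mul_of_nonneg_left (h.norm_step_sub_step_le hη hηβ D i z w _ _ _)
            (nonneg_of_mem_doublyStochastic hP)
      _ = ∑ w, P v w * (∑ i, ‖distSGD loss P η x₀ D K k w
            - distSGD loss P η x₀ (replaceSample D i z) K k w‖ + 2 * η * L) := by
          rw [Finset.sum_comm]
          refine Finset.sum_congr rfl fun w _ => ?_
          rw [← Finset.mul_sum, Finset.sum_add_distrib, Finset.sum_ite_eq' Finset.univ]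
          simp
      _ ≤ ∑ w, P v w * (2 * η * L * k + 2 * η * L) := by
          refine Finset.sum_le_sum fun w _ => mul_le_mul_of_nonneg_left ?_
            (nonneg_of_mem_doublyStochastic hP)
          linarith [ih w]
      _ = 2 * η * L * (k + 1 : ℕ) := by
          rw [← Finset.sum_mul, sum_row_of_mem_doublyStochastic hP]; push_cast; ring

lemma IsRegularLoss.sum_norm_ergodicAverage_replaceSample_le (h : IsRegularLoss L β loss)
    (hP : P ∈ doublyStochastic ℝ (Fin n)) (hη : 0 ≤ η) (hηβ : η * β ≤ 2) (x₀ : Fin n → Model d)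
    (D : Fin n → Fin m → Z) (z : Z) (K : ℕ → Fin n → Fin m) {t : ℕ} (ht : 1 ≤ t) (v : Fin n) :
    ∑ i, ‖ergodicAverage loss P η x₀ D K t v
      - ergodicAverage loss P η x₀ (replaceSample D i z) K t v‖ ≤ η * L * (t + 1) := by
  have ht' : (0 : ℝ) < t := by exact_mod_cast ht
  have h1 : ∀ i, ‖ergodicAverage loss P η x₀ D K t v
      - ergodicAverage loss P η x₀ (replaceSample D i z) K t v‖ ≤
      1 / (t : ℝ) * ∑ s ∈ Finset.Icc 1 t, ‖distSGD loss P η x₀ D K s v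
        - distSGD loss P η x₀ (replaceSample D i z) K s v‖ := fun i => by
    unfold ergodicAverage
    rw [← smul_sub, ← Finset.sum_sub_distrib, norm_smul, Real.norm_of_nonneg (by positivity)]
    gcongr
    exact norm_sum_le _ _
  refine (Finset.sum_le_sum fun i _ => h1 i).trans ?_
  rw [← Finset.mul_sum, Finset.sum_comm]
  have h2 : ∑ s ∈ Finset.Icc 1 t, (s : ℝ) = t * (t + 1) / 2 := by
    clear h1 ht ht'
    induction t with
    | zero => simp
    | succ t ih => rw [Finset.sum_Icc_succ_top (by omega), ih]; push_cast; ring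
  calc 1 / (t : ℝ) * ∑ s ∈ Finset.Icc 1 t, ∑ i, ‖distSGD loss P η x₀ D K s v
        - distSGD loss P η x₀ (replaceSample D i z) K s v‖
      ≤ 1 / (t : ℝ) * ∑ s ∈ Finset.Icc 1 t, 2 * η * L * s := by
        gcongr
        exact h.sum_norm_distSGD_replaceSample_le hP hη hηβ x₀ D z K _ v
    _ = η * L * (t + 1) := by rw [← Finset.mul_sum, h2]; field_simp

/-! ### Elementary properties of the iterates -/

lemma IsRegularLoss.norm_distSGD_zero_le (h : IsRegularLoss L β loss)
    (hP : P ∈ doublyStochastic ℝ (Fin n)) (hη : 0 ≤ η)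
    (D : Fin n → Fin m → Z) (K : ℕ → Fin n → Fin m) (k : ℕ) (v : Fin n) :
    ‖distSGD loss P η (fun _ => 0) D K k v‖ ≤ η * L * k := by
  induction k generalizing v with
  | zero => simp [distSGD]
  | succ k ih =>
    rw [distSGD_succ]
    calc ‖∑ w, P v w • (distSGD loss P η (fun _ => 0) D K k w
            - η • lossGrad loss (distSGD loss P η (fun _ => 0) D K k w) (D w (K k w)))‖
        ≤ ∑ w, P v w * (η * L * k + η * L) := by
          refine norm_sum_le_of_le _ fun w _ => ?_
          rw [norm_smul, Real.norm_of_nonneg (nonneg_of_mem_doublyStochastic hP)]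
          refine mul_le_mul_of_nonneg_left ((norm_sub_le _ _).trans (add_le_add (ih w) ?_))
            (nonneg_of_mem_doublyStochastic hP)
          rw [norm_smul, Real.norm_of_nonneg hη]
          exact mul_le_mul_of_nonneg_left (h.norm_lossGrad_le _ _) hη
      _ = η * L * (k + 1 : ℕ) := by
          rw [← Finset.sum_mul, sum_row_of_mem_doublyStochastic hP]; push_cast; ring

lemma IsRegularLoss.norm_ergodicAverage_le (h : IsRegularLoss L β loss)
    (hP : P ∈ doublyStochastic ℝ (Fin n)) (hη : 0 ≤ η)
    (D : Fin n → Fin m → Z) (K : ℕ → Fin n → Fin m) {t : ℕ} (ht : 1 ≤ t) (v : Fin n) :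
    ‖ergodicAverage loss P η (fun _ => 0) D K t v‖ ≤ η * L * t := by
  have ht' : (0 : ℝ) < t := by exact_mod_cast ht
  have hL := h.L_nonneg
  unfold ergodicAverage
  rw [norm_smul, Real.norm_of_nonneg (by positivity)]
  have h1 : ‖∑ s ∈ Finset.Icc 1 t, distSGD loss P η (fun _ => 0) D K s v‖ ≤
      ∑ s ∈ Finset.Icc 1 t, η * L * t :=
    norm_sum_le_of_le _ fun s hs => (h.norm_distSGD_zero_le hP hη D K s v).trans (by
      have : (s : ℝ) ≤ t := by exact_mod_cast (Finset.mem_Icc.1 hs).2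
      gcongr)
  calc 1 / (t : ℝ) * ‖∑ s ∈ Finset.Icc 1 t, distSGD loss P η (fun _ => 0) D K s v‖
      ≤ 1 / (t : ℝ) * ∑ s ∈ Finset.Icc 1 t, η * L * t := by gcongr
    _ = η * L * t := by simp; field_simp

lemma distSGD_congr_index (x₀ : Fin n → Model d) (D : Fin n → Fin m → Z)
    {K K' : ℕ → Fin n → Fin m} {k : ℕ} (hK : ∀ j < k, K j = K' j) :
    distSGD loss P η x₀ D K k = distSGD loss P η x₀ D K' k := by
  induction k with
  | zero => rfl
  | succ k ih =>
    funext v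
    rw [distSGD_succ, distSGD_succ, ih fun j hj => hK j (hj.trans k.lt_succ_self),
      hK k k.lt_succ_self]

/-- The stochastic gradient that node `w` evaluates at its `k`-th iterate. -/
noncomputable def stochGrad (loss : Model d → Z → ℝ) (P : Matrix (Fin n) (Fin n) ℝ) (η : ℝ)
    (D : Fin n → Fin m → Z) (K : ℕ → Fin n → Fin m) (k : ℕ) (w : Fin n) : Model d :=
  lossGrad loss (distSGD loss P η (fun _ => 0) D K k w) (D w (K k w))

/-- The gradient of the local empirical risk of node `w` at its `k`-th iterate. -/
noncomputable def fullGrad (loss : Model d → Z → ℝ) (P : Matrix (Fin n) (Fin n) ℝ) (η : ℝ)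
    (D : Fin n → Fin m → Z) (K : ℕ → Fin n → Fin m) (k : ℕ) (w : Fin n) : Model d :=
  gradient (localRisk loss D w) (distSGD loss P η (fun _ => 0) D K k w)

/-- The network average of the `k`-th iterates. -/
noncomputable def meanIterate (loss : Model d → Z → ℝ) (P : Matrix (Fin n) (Fin n) ℝ) (η : ℝ)
    (D : Fin n → Fin m → Z) (K : ℕ → Fin n → Fin m) (k : ℕ) : Model d :=
  (1 / (n : ℝ)) • ∑ w, distSGD loss P η (fun _ => 0) D K k w

variable (loss P η) in
/-- The iterates started from zero are weighted sums of the past stochastic gradients. -/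
lemma distSGD_zero_eq_sum (D : Fin n → Fin m → Z) (K : ℕ → Fin n → Fin m) (k : ℕ) (v : Fin n) :
    distSGD loss P η (fun _ => 0) D K k v =
      -(η • ∑ j ∈ Finset.range k, ∑ w, (P ^ (k - j)) v w • stochGrad loss P η D K j w) := by
  induction k generalizing v with
  | zero => simp [distSGD]
  | succ k ih =>
    have h1 : ∑ w, P v w • distSGD loss P η (fun _ => 0) D K k w =
        -(η • ∑ j ∈ Finset.range k, ∑ w, (P ^ (k + 1 - j)) v w • stochGrad loss P η D K j w) := by
      calc ∑ w, P v w • distSGD loss P η (fun _ => 0) D K k w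
          = -(η • ∑ w, ∑ j ∈ Finset.range k, ∑ u,
              (P v w * (P ^ (k - j)) w u) • stochGrad loss P η D K j u) := by
            rw [Finset.smul_sum, ← Finset.sum_neg_distrib]
            refine Finset.sum_congr rfl fun w _ => ?_
            rw [ih w, smul_neg, smul_comm]
            simp only [Finset.smul_sum, smul_smul]
        _ = _ := by
            rw [Finset.sum_comm]
            congr 2
            refine Finset.sum_congr rfl fun j hj => ?_
            rw [Finset.sum_comm]
            refine Finset.sum_congr rfl fun u _ => ?_
            rw [← Finset.sum_smul, Nat.succ_sub (Finset.mem_range.1 hj).le, pow_succ',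
              Matrix.mul_apply]
    rw [distSGD_succ]
    simp only [smul_sub, Finset.sum_sub_distrib]
    rw [h1, Finset.sum_range_succ, Nat.add_sub_cancel_left, pow_one, smul_add, neg_add,
      ← sub_eq_add_neg, Finset.smul_sum (r := η) (f := fun w => P v w • _)]
    congr 1
    exact Finset.sum_congr rfl fun w _ => smul_comm _ _ _

lemma meanIterate_succ (hP : P ∈ doublyStochastic ℝ (Fin n)) (D : Fin n → Fin m → Z)
    (K : ℕ → Fin n → Fin m) (k : ℕ) :
    meanIterate loss P η D K (k + 1) =
      meanIterate loss P η D K k - η • ((1 / (n : ℝ)) • ∑ w, stochGrad loss P η D K k w) := by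
  unfold meanIterate
  simp only [distSGD_succ]
  rw [Finset.sum_comm, smul_comm η, ← smul_sub, Finset.smul_sum (r := η), ← Finset.sum_sub_distrib]
  congr 1
  refine Finset.sum_congr rfl fun w _ => ?_
  rw [← Finset.sum_smul, sum_col_of_mem_doublyStochastic hP, one_smul]
  rfl

lemma meanIterate_eq_sum (hP : P ∈ doublyStochastic ℝ (Fin n)) (D : Fin n → Fin m → Z)
    (K : ℕ → Fin n → Fin m) (k : ℕ) :
    meanIterate loss P η D K k =
      -(η • ∑ j ∈ Finset.range k, ∑ w, (1 / (n : ℝ)) • stochGrad loss P η D K j w) := by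
  induction k with
  | zero => simp [meanIterate, distSGD]
  | succ k ih =>
    rw [meanIterate_succ hP, ih, Finset.sum_range_succ, smul_add, neg_add, sub_eq_add_neg,
      ← Finset.smul_sum (r := 1 / (n : ℝ))]

/-- The distance of an iterate to the network average, in terms of the stochastic gradients. Rows of
powers of `P` and of the averaging matrix have the same sum, so the gradients may be centred. -/
lemma norm_distSGD_sub_meanIterate_le (hP : P ∈ doublyStochastic ℝ (Fin n)) (hη : 0 ≤ η)
    (D : Fin n → Fin m → Z) (K : ℕ → Fin n → Fin m) (c : ℕ → Model d) (k : ℕ) (v : Fin n) :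
    ‖distSGD loss P η (fun _ => 0) D K k v - meanIterate loss P η D K k‖ ≤
      η * ∑ j ∈ Finset.range k, ∑ w, |(P ^ (k - j)) v w - 1 / (n : ℝ)| *
        ‖stochGrad loss P η D K j w - c j‖ := by
  have hn : (n : ℝ) ≠ 0 := by have := v.pos; positivity
  have e : distSGD loss P η (fun _ => 0) D K k v - meanIterate loss P η D K k =
      -(η • ∑ j ∈ Finset.range k, ∑ w, ((P ^ (k - j)) v w - 1 / (n : ℝ)) •
        (stochGrad loss P η D K j w - c j)) := by
    rw [distSGD_zero_eq_sum, meanIterate_eq_sum hP, neg_sub_neg, ← neg_sub, ← smul_sub,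
      ← Finset.sum_sub_distrib]
    congr 2
    refine Finset.sum_congr rfl fun j _ => ?_
    simp only [smul_sub, Finset.sum_sub_distrib, sub_smul]
    have h1 : ∑ w : Fin n, (P ^ (k - j)) v w • c j = c j := by
      rw [← Finset.sum_smul, sum_row_of_mem_doublyStochastic (pow_mem hP _), one_smul]
    have h2 : ∑ _w : Fin n, (1 / (n : ℝ)) • c j = c j := by
      rw [← Finset.sum_smul]; simp [hn]
    rw [h1, h2]; abel
  rw [e, norm_neg, norm_smul, Real.norm_of_nonneg hη]
  refine mul_le_mul_of_nonneg_left ?_ hη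
  refine norm_sum_le_of_le _ fun j _ => norm_sum_le_of_le _ fun w _ => ?_
  rw [norm_smul, Real.norm_eq_abs]

/-! ### The optimisation inequality along a trajectory -/

/-- The decomposition of a mean squared distance into squared bias and variance. -/
lemma sum_norm_sub_sq_eq (hn : 0 < n) (x : Fin n → Model d) (y : Model d) :
    1 / (n : ℝ) * ∑ w, ‖y - x w‖ ^ 2 = ‖y - (1 / (n : ℝ)) • ∑ w, x w‖ ^ 2
      + 1 / (n : ℝ) * ∑ w, ‖x w - (1 / (n : ℝ)) • ∑ w, x w‖ ^ 2 := by
  have hn' : (n : ℝ) ≠ 0 := by positivity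
  set a := (1 / (n : ℝ)) • ∑ w, x w with ha
  have h1 : ∀ w, ‖y - x w‖ ^ 2 = ‖y - a‖ ^ 2 - 2 * ⟪y - a, x w - a⟫ + ‖x w - a‖ ^ 2 := fun w => by
    rw [← norm_sub_sq_real]; congr 2; abel
  have h2 : ∑ w, ⟪y - a, x w - a⟫ = 0 := by
    rw [← inner_sum, Finset.sum_sub_distrib]
    have : ∑ _w : Fin n, a = ∑ w, x w := by
      rw [Finset.sum_const, Finset.card_univ, Fintype.card_fin, ha, ← Nat.cast_smul_eq_nsmul ℝ,
        smul_smul, mul_one_div_cancel hn', one_smul]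
    rw [this, sub_self, inner_zero_right]
  simp only [h1, Finset.sum_add_distrib, Finset.sum_sub_distrib, ← Finset.mul_sum, h2]
  simp [mul_add, hn']

lemma norm_mean_sq_le (x : Fin n → Model d) :
    ‖(1 / (n : ℝ)) • ∑ w, x w‖ ^ 2 ≤ 1 / (n : ℝ) * ∑ w, ‖x w‖ ^ 2 := by
  rcases Nat.eq_zero_or_pos n with hn | hn
  · subst hn; simp
  have h := sum_norm_sub_sq_eq hn x 0
  simp only [zero_sub, norm_neg] at h
  rw [h]
  have : 0 ≤ 1 / (n : ℝ) * ∑ w, ‖x w - (1 / (n : ℝ)) • ∑ w, x w‖ ^ 2 := by positivity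
  linarith

lemma IsRegularLoss.localRisk_sub_le (h : IsRegularLoss L β loss) (hm : 0 < m)
    (D : Fin n → Fin m → Z) (w : Fin n) (x y z : Model d) :
    localRisk loss D w y - localRisk loss D w z ≤
      ⟪gradient (localRisk loss D w) x, y - z⟫ + β / 2 * ‖y - x‖ ^ 2 := by
  have hm' : (m : ℝ) ≠ 0 := by positivity
  rw [h.gradient_localRisk]
  unfold localRisk
  rw [← mul_sub, ← Finset.sum_sub_distrib, inner_smul_left, sum_inner]
  have h1 : ∑ i, (loss y (D w i) - loss z (D w i)) ≤
      ∑ i, ⟪lossGrad loss x (D w i), y - z⟫ + m * (β / 2 * ‖y - x‖ ^ 2) := by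
    refine (Finset.sum_le_sum fun i _ =>
      (h.smooth (D w i)).sub_le_inner (h.convex _) x y z).trans (le_of_eq ?_)
    rw [Finset.sum_add_distrib, Finset.sum_const, Finset.card_univ, Fintype.card_fin, nsmul_eq_mul]
    rfl
  calc 1 / (m : ℝ) * ∑ i, (loss y (D w i) - loss z (D w i))
      ≤ 1 / (m : ℝ) * (∑ i, ⟪lossGrad loss x (D w i), y - z⟫ + m * (β / 2 * ‖y - x‖ ^ 2)) := by
        gcongr
    _ = _ := by simp [mul_add, hm']

lemma IsRegularLoss.localRisk_sub_le_norm (h : IsRegularLoss L β loss) (hm : 0 < m)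
    (D : Fin n → Fin m → Z) (w : Fin n) (x y : Model d) :
    localRisk loss D w x - localRisk loss D w y ≤ L * ‖x - y‖ := by
  have hm' : (m : ℝ) ≠ 0 := by positivity
  unfold localRisk
  rw [← mul_sub, ← Finset.sum_sub_distrib]
  calc 1 / (m : ℝ) * ∑ i, (loss x (D w i) - loss y (D w i))
      ≤ 1 / (m : ℝ) * ∑ _i : Fin m, L * ‖x - y‖ := by
        gcongr with i
        exact (le_abs_self _).trans (h.lipschitz (D w i) x y)
    _ = _ := by simp [hm']

lemma IsRegularLoss.empiricalRisk_sub_le_norm (h : IsRegularLoss L β loss) (hn : 0 < n)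
    (hm : 0 < m) (D : Fin n → Fin m → Z) (x y : Model d) :
    empiricalRisk loss D x - empiricalRisk loss D y ≤ L * ‖x - y‖ := by
  have hn' : (n : ℝ) ≠ 0 := by positivity
  unfold empiricalRisk
  rw [← mul_sub, ← Finset.sum_sub_distrib]
  calc 1 / (n : ℝ) * ∑ w, (localRisk loss D w x - localRisk loss D w y)
      ≤ 1 / (n : ℝ) * ∑ _w : Fin n, L * ‖x - y‖ := by
        gcongr with w
        exact h.localRisk_sub_le_norm hm D w x y
    _ = _ := by simp [hn']

lemma convexOn_const_mul_sum {ι : Type*} [Fintype ι] {E : Type*} [AddCommMonoid E] [Module ℝ E]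
    {f : ι → E → ℝ} (hf : ∀ i, ConvexOn ℝ Set.univ (f i)) {c : ℝ} (hc : 0 ≤ c) :
    ConvexOn ℝ Set.univ fun x => c * ∑ i, f i x := by
  refine ConvexOn.smul hc ⟨convex_univ, fun x hx y hy a b ha hb hab => ?_⟩
  rw [Finset.smul_sum, Finset.smul_sum, ← Finset.sum_add_distrib]
  exact Finset.sum_le_sum fun i _ => (hf i).2 hx hy ha hb hab

lemma IsRegularLoss.convexOn_empiricalRisk (h : IsRegularLoss L β loss) (D : Fin n → Fin m → Z) :
    ConvexOn ℝ Set.univ (empiricalRisk loss D) :=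
  convexOn_const_mul_sum
    (fun w => convexOn_const_mul_sum (fun i => h.convex (D w i)) (by positivity)) (by positivity)

/-- The empirical risk as a function of the local points at which its gradients are evaluated:
inexactness of the gradient costs only the variance of the local points. -/
lemma IsRegularLoss.empiricalRisk_sub_le (h : IsRegularLoss L β loss) (hn : 0 < n) (hm : 0 < m)
    (D : Fin n → Fin m → Z) (x : Fin n → Model d) (y z : Model d) :
    empiricalRisk loss D y - empiricalRisk loss D z ≤
      ⟪(1 / (n : ℝ)) • ∑ w, gradient (localRisk loss D w) (x w), y - z⟫
      + β / 2 * (‖y - (1 / (n : ℝ)) • ∑ w, x w‖ ^ 2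
        + 1 / (n : ℝ) * ∑ w, ‖x w - (1 / (n : ℝ)) • ∑ w, x w‖ ^ 2) := by
  rw [← sum_norm_sub_sq_eq hn, inner_smul_left, sum_inner]
  unfold empiricalRisk
  rw [← mul_sub, ← Finset.sum_sub_distrib]
  calc 1 / (n : ℝ) * ∑ w, (localRisk loss D w y - localRisk loss D w z)
      ≤ 1 / (n : ℝ) * ∑ w, (⟪gradient (localRisk loss D w) (x w), y - z⟫
          + β / 2 * ‖y - x w‖ ^ 2) := by
        gcongr with w
        exact h.localRisk_sub_le hm D w (x w) y z
    _ = _ := by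
        rw [Finset.sum_add_distrib, ← Finset.mul_sum]
        simp only [conj_trivial]
        ring

/-- One round of the averaged dynamics. The step size `1 / (β + 1 / ρ)` is chosen so that the
squared displacements from smoothness and from the noise cancel against the one gained by the
proximal identity. -/
lemma IsRegularLoss.empiricalRisk_meanIterate_succ_sub_le (h : IsRegularLoss L β loss)
    (hn : 0 < n) (hm : 0 < m) (hP : P ∈ doublyStochastic ℝ (Fin n)) {ρ : ℝ} (hρ : 0 < ρ)
    (hη : η = 1 / (β + 1 / ρ)) (D : Fin n → Fin m → Z) (K : ℕ → Fin n → Fin m) (k : ℕ)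
    (y : Model d) :
    empiricalRisk loss D (meanIterate loss P η D K (k + 1)) - empiricalRisk loss D y ≤
      (β + 1 / ρ) / 2 * (‖meanIterate loss P η D K k - y‖ ^ 2
        - ‖meanIterate loss P η D K (k + 1) - y‖ ^ 2)
      + ⟪(1 / (n : ℝ)) • ∑ w, (fullGrad loss P η D K k w - stochGrad loss P η D K k w),
          meanIterate loss P η D K k - y⟫
      + ρ / 2 * (1 / (n : ℝ) * ∑ w, ‖stochGrad loss P η D K k w - fullGrad loss P η D K k w‖ ^ 2)
      + β / 2 * (1 / (n : ℝ) * ∑ w,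
          ‖distSGD loss P η (fun _ => 0) D K k w - meanIterate loss P η D K k‖ ^ 2) := by
  have hβ := h.β_pos
  have hB : 0 < β + 1 / ρ := by positivity
  have h1 := h.empiricalRisk_sub_le hn hm D (fun w => distSGD loss P η (fun _ => 0) D K k w)
    (meanIterate loss P η D K (k + 1)) y
  have hs := meanIterate_succ (loss := loss) (η := η) hP D K k
  change _ ≤ ⟪(1 / (n : ℝ)) • ∑ w, fullGrad loss P η D K k w, _⟫ + β / 2 * (‖_ -
    meanIterate loss P η D K k‖ ^ 2 + 1 / (n : ℝ) * ∑ w, ‖_ - meanIterate loss P η D K k‖ ^ 2) at h1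
  set a := meanIterate loss P η D K k
  set b := meanIterate loss P η D K (k + 1)
  set g := (1 / (n : ℝ)) • ∑ w, stochGrad loss P η D K k w with hg
  set f := (1 / (n : ℝ)) • ∑ w, fullGrad loss P η D K k w with hf
  have hfg : (1 / (n : ℝ)) • ∑ w, (fullGrad loss P η D K k w - stochGrad loss P η D K k w) =
      f - g := by
    rw [Finset.sum_sub_distrib, smul_sub]
  have hnoise : ‖f - g‖ ^ 2 ≤
      1 / (n : ℝ) * ∑ w, ‖stochGrad loss P η D K k w - fullGrad loss P η D K k w‖ ^ 2 := by
    rw [← hfg]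
    refine (norm_mean_sq_le _).trans (le_of_eq ?_)
    simp only [norm_sub_rev]
  rw [hfg]
  have hgab : g = (β + 1 / ρ) • (a - b) := by
    rw [hs, sub_sub_cancel, smul_smul, hη, mul_one_div_cancel hB.ne', one_smul]
  have e1 : ⟪f, b - y⟫ = ⟪g, b - y⟫ + ⟪f - g, a - y⟫ + ⟪f - g, b - a⟫ := by
    rw [add_assoc, ← inner_add_right, inner_sub_left (x := f)]
    have : a - y + (b - a) = b - y := by abel
    rw [this]; ring
  have e2 : ⟪g, b - y⟫ = (β + 1 / ρ) / 2 * (‖a - y‖ ^ 2 - ‖b - y‖ ^ 2 - ‖b - a‖ ^ 2) := by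
    have : a - y = (a - b) + (b - y) := by abel
    rw [hgab, inner_smul_left, this, norm_add_sq_real, norm_sub_rev b a]
    simp only [conj_trivial]
    ring
  have e3 : ⟪f - g, b - a⟫ ≤ ρ / 2 * ‖f - g‖ ^ 2 + 1 / ρ / 2 * ‖b - a‖ ^ 2 := by
    refine (real_inner_le_norm _ _).trans ?_
    have : 0 ≤ 1 / ρ / 2 * (ρ * ‖f - g‖ - ‖b - a‖) ^ 2 := by positivity
    have e : 1 / ρ / 2 * (ρ * ‖f - g‖ - ‖b - a‖) ^ 2 =
        ρ / 2 * ‖f - g‖ ^ 2 + 1 / ρ / 2 * ‖b - a‖ ^ 2 - ‖f - g‖ * ‖b - a‖ := by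
      field_simp; ring
    linarith
  have e4 : ρ / 2 * ‖f - g‖ ^ 2 ≤ ρ / 2 * (1 / (n : ℝ) *
      ∑ w, ‖stochGrad loss P η D K k w - fullGrad loss P η D K k w‖ ^ 2) := by gcongr
  nlinarith [h1, e1, e2, e3, e4]

/-- The part of the optimisation error of the trajectory that is controlled by the gradient noise
and by the disagreement of the nodes. -/
noncomputable def trajectoryResidual (loss : Model d → Z → ℝ)
    (P : Matrix (Fin n) (Fin n) ℝ) (L β ρ η : ℝ)
    (D : Fin n → Fin m → Z) (K : ℕ → Fin n → Fin m) (v : Fin n) (k : ℕ) : ℝ :=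
  ρ / 2 * (1 / (n : ℝ) * ∑ w, ‖stochGrad loss P η D K k w - fullGrad loss P η D K k w‖ ^ 2)
  + β / 2 * (1 / (n : ℝ) * ∑ w,
      ‖distSGD loss P η (fun _ => 0) D K k w - meanIterate loss P η D K k‖ ^ 2)
  + L * ‖distSGD loss P η (fun _ => 0) D K (k + 1) v - meanIterate loss P η D K (k + 1)‖

/-- The optimisation error of the ergodic average along a trajectory, relative to any model `y` of
norm at most `G`: an initial error, the residuals, and inner products with the gradient noise. -/
lemma IsRegularLoss.empiricalRisk_ergodicAverage_sub_le (h : IsRegularLoss L β loss)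
    (hm : 0 < m) (hP : P ∈ doublyStochastic ℝ (Fin n)) {ρ : ℝ} (hρ : 0 < ρ)
    (hη : η = 1 / (β + 1 / ρ)) (D : Fin n → Fin m → Z) (K : ℕ → Fin n → Fin m) {t : ℕ}
    (ht : 1 ≤ t) (v : Fin n) {y : Model d} {G : ℝ} (hy : ‖y‖ ≤ G) :
    empiricalRisk loss D (ergodicAverage loss P η (fun _ => 0) D K t v) - empiricalRisk loss D y ≤
      (β + 1 / ρ) * G ^ 2 / (2 * t)
      + 1 / (t : ℝ) * ∑ k ∈ Finset.range t, trajectoryResidual loss P L β ρ η D K v k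
      + 1 / (t : ℝ) * ∑ k ∈ Finset.range t,
        ⟪(1 / (n : ℝ)) • ∑ w, (fullGrad loss P η D K k w - stochGrad loss P η D K k w),
          meanIterate loss P η D K k - y⟫ := by
  have ht' : (0 : ℝ) < t := by exact_mod_cast ht
  have hβ := h.β_pos
  have hconv : empiricalRisk loss D (ergodicAverage loss P η (fun _ => 0) D K t v) ≤
      1 / (t : ℝ) * ∑ k ∈ Finset.range t,
        empiricalRisk loss D (distSGD loss P η (fun _ => 0) D K (k + 1) v) := by
    have e : ergodicAverage loss P η (fun _ => 0) D K t v = ∑ k ∈ Finset.range t,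
        (1 / (t : ℝ)) • distSGD loss P η (fun _ => 0) D K (k + 1) v := by
      rw [ergodicAverage, Finset.smul_sum, Finset.range_eq_Ico,
        Finset.sum_Ico_add' (fun s => (1 / (t : ℝ)) • distSGD loss P η (fun _ => 0) D K s v) 0 t 1]
      rfl
    rw [e, Finset.mul_sum]
    exact (h.convexOn_empiricalRisk D).map_sum_le (fun _ _ => by positivity)
      (by simp [ht'.ne']) (fun _ _ => Set.mem_univ _)
  have hstep : ∀ k, empiricalRisk loss D (distSGD loss P η (fun _ => 0) D K (k + 1) v)
      - empiricalRisk loss D y ≤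
      (β + 1 / ρ) / 2 * (‖meanIterate loss P η D K k - y‖ ^ 2
        - ‖meanIterate loss P η D K (k + 1) - y‖ ^ 2)
      + trajectoryResidual loss P L β ρ η D K v k
      + ⟪(1 / (n : ℝ)) • ∑ w, (fullGrad loss P η D K k w - stochGrad loss P η D K k w),
          meanIterate loss P η D K k - y⟫ := fun k => by
    have h1 := h.empiricalRisk_meanIterate_succ_sub_le v.pos hm hP hρ hη D K k y
    have h2 := h.empiricalRisk_sub_le_norm v.pos hm D
      (distSGD loss P η (fun _ => 0) D K (k + 1) v) (meanIterate loss P η D K (k + 1))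
    unfold trajectoryResidual
    linarith
  have hsum := Finset.sum_le_sum fun k (_ : k ∈ Finset.range t) => hstep k
  rw [Finset.sum_sub_distrib, Finset.sum_const, Finset.card_range, nsmul_eq_mul,
    Finset.sum_add_distrib, Finset.sum_add_distrib, ← Finset.mul_sum,
    Finset.sum_range_sub'] at hsum
  have h0 : meanIterate loss P η D K 0 = 0 := by simp [meanIterate, distSGD]
  rw [h0, zero_sub, norm_neg] at hsum
  have hG : (β + 1 / ρ) / 2 * (‖y‖ ^ 2 - ‖meanIterate loss P η D K t - y‖ ^ 2) ≤
      (β + 1 / ρ) / 2 * G ^ 2 := by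
    have : ‖y‖ ^ 2 ≤ G ^ 2 := pow_le_pow_left₀ (norm_nonneg _) hy 2
    have : 0 ≤ ‖meanIterate loss P η D K t - y‖ ^ 2 := by positivity
    gcongr
    linarith
  set S := ∑ k ∈ Finset.range t,
    empiricalRisk loss D (distSGD loss P η (fun _ => 0) D K (k + 1) v)
  set R := ∑ k ∈ Finset.range t, trajectoryResidual loss P L β ρ η D K v k
  set I := ∑ k ∈ Finset.range t,
        ⟪(1 / (n : ℝ)) • ∑ w, (fullGrad loss P η D K k w - stochGrad loss P η D K k w),
          meanIterate loss P η D K k - y⟫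
  have hfin : 1 / (t : ℝ) * (S - t * empiricalRisk loss D y) ≤
      1 / (t : ℝ) * ((β + 1 / ρ) / 2 * G ^ 2 + R + I) := by
    gcongr; linarith
  have e1 : 1 / (t : ℝ) * (S - t * empiricalRisk loss D y) =
      1 / (t : ℝ) * S - empiricalRisk loss D y := by field_simp
  have e2 : 1 / (t : ℝ) * ((β + 1 / ρ) / 2 * G ^ 2 + R + I) =
      (β + 1 / ρ) * G ^ 2 / (2 * t) + 1 / (t : ℝ) * R + 1 / (t : ℝ) * I := by field_simp
  linarith

end Algorithm

/-! ### Measurability -/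

section Measurability

open scoped RealInnerProductSpace

variable {d n m : ℕ} {Z : Type*} {loss : Model d → Z → ℝ} {L β : ℝ}
  {P : Matrix (Fin n) (Fin n) ℝ} {η : ℝ}

lemma IsRegularLoss.continuous (h : IsRegularLoss L β loss) (z : Z) :
    Continuous (fun x => loss x z) :=
  (h.smooth z).1.continuous

lemma IsRegularLoss.continuous_lossGrad (h : IsRegularLoss L β loss) (z : Z) :
    Continuous (fun x => lossGrad loss x z) := by
  refine (LipschitzWith.of_dist_le_mul (K := β.toNNReal) fun x y => ?_).continuous
  rw [dist_eq_norm, dist_eq_norm, Real.coe_toNNReal _ h.β_pos.le]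
  exact (h.smooth z).2 x y

variable [MeasurableSpace Z]

lemma IsRegularLoss.measurable_uncurry_loss (h : IsRegularLoss L β loss)
    (hmeas : ∀ x, Measurable (loss x)) : Measurable (Function.uncurry loss) :=
  measurable_uncurry_of_continuous_of_measurable h.continuous hmeas

/-- The gradient of the loss is jointly measurable: its coordinates are limits of difference
quotients, and it is continuous in the model. -/
lemma IsRegularLoss.measurable_uncurry_lossGrad (h : IsRegularLoss L β loss)
    (hmeas : ∀ x, Measurable (loss x)) : Measurable (Function.uncurry (lossGrad loss)) := by
  refine measurable_uncurry_of_continuous_of_measurable h.continuous_lossGrad fun x => ?_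
  let b := EuclideanSpace.basisFun (Fin d) ℝ
  have e : lossGrad loss x = fun z => ∑ i, ⟪b i, lossGrad loss x z⟫ • b i :=
    funext fun z => (b.sum_repr' (lossGrad loss x z)).symm
  rw [e]
  refine Finset.measurable_sum _ fun i _ => Measurable.smul_const ?_ _
  have hlim : ∀ z, Filter.Tendsto
      (fun k : ℕ => (k : ℝ) • (loss (x + (k : ℝ)⁻¹ • b i) z - loss x z)) Filter.atTop
      (nhds ⟪b i, lossGrad loss x z⟫) := fun z => by
    have h1 := ((h.smooth z).1 x).hasFDerivAt.lim (b i)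
      (c := fun k : ℕ => (k : ℝ)) (l := Filter.atTop)
      (by simpa using tendsto_natCast_atTop_atTop (R := ℝ))
    rw [real_inner_comm]
    unfold lossGrad
    rwa [inner_gradient_left]
  refine measurable_of_tendsto_metrizable (fun k => ?_) (tendsto_pi_nhds.2 hlim)
  exact ((hmeas (x + (k : ℝ)⁻¹ • b i)).sub (hmeas x)).const_mul (k : ℝ)

lemma measurable_sample (w : Fin n) (k : ℕ) :
    Measurable fun p : (Fin n → Fin m → Z) × (ℕ → Fin n → Fin m) => p.1 w (p.2 k w) := by
  have h1 : Measurable fun q : (Fin m → Z) × Fin m => q.1 q.2 :=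
    measurable_from_prod_countable_left fun i => measurable_pi_apply i
  have h2 : Measurable fun p : (Fin n → Fin m → Z) × (ℕ → Fin n → Fin m) => (p.1 w, p.2 k w) := by
    fun_prop
  exact h1.comp h2

lemma IsRegularLoss.measurable_distSGD (h : IsRegularLoss L β loss)
    (hmeas : ∀ x, Measurable (loss x)) (k : ℕ) (v : Fin n) :
    Measurable fun p : (Fin n → Fin m → Z) × (ℕ → Fin n → Fin m) =>
      distSGD loss P η (fun _ => 0) p.1 p.2 k v := by
  induction k generalizing v with
  | zero => exact measurable_const
  | succ k ih =>
    simp only [distSGD_succ]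
    refine Finset.measurable_sum _ fun w _ => Measurable.fun_const_smul ((ih w).sub ?_) (P v w)
    exact ((h.measurable_uncurry_lossGrad hmeas).comp
      ((ih w).prodMk (measurable_sample w k))).fun_const_smul η

lemma IsRegularLoss.measurable_ergodicAverage (h : IsRegularLoss L β loss)
    (hmeas : ∀ x, Measurable (loss x)) (t : ℕ) (v : Fin n) :
    Measurable fun p : (Fin n → Fin m → Z) × (ℕ → Fin n → Fin m) =>
      ergodicAverage loss P η (fun _ => 0) p.1 p.2 t v :=
  (Finset.measurable_sum (Finset.Icc 1 t) fun s _ =>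
    h.measurable_distSGD hmeas s v).fun_const_smul (1 / (t : ℝ))

lemma IsRegularLoss.measurable_stochGrad (h : IsRegularLoss L β loss)
    (hmeas : ∀ x, Measurable (loss x)) (k : ℕ) (w : Fin n) :
    Measurable fun p : (Fin n → Fin m → Z) × (ℕ → Fin n → Fin m) =>
      stochGrad loss P η p.1 p.2 k w :=
  (h.measurable_uncurry_lossGrad hmeas).comp
    ((h.measurable_distSGD hmeas k w).prodMk (measurable_sample w k))

lemma measurable_sample_apply (w : Fin n) (i : Fin m) :
    Measurable fun p : (Fin n → Fin m → Z) × (ℕ → Fin n → Fin m) => p.1 w i :=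
  (measurable_pi_apply i).comp ((measurable_pi_apply w).comp measurable_fst)

lemma IsRegularLoss.measurable_fullGrad (h : IsRegularLoss L β loss)
    (hmeas : ∀ x, Measurable (loss x)) (k : ℕ) (w : Fin n) :
    Measurable fun p : (Fin n → Fin m → Z) × (ℕ → Fin n → Fin m) =>
      fullGrad loss P η p.1 p.2 k w := by
  simp only [fullGrad, h.gradient_localRisk]
  exact (Finset.measurable_sum Finset.univ fun i _ => (h.measurable_uncurry_lossGrad hmeas).comp
    ((h.measurable_distSGD hmeas k w).prodMk (measurable_sample_apply w i))).fun_const_smul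
      (1 / (m : ℝ))

lemma IsRegularLoss.measurable_meanIterate (h : IsRegularLoss L β loss)
    (hmeas : ∀ x, Measurable (loss x)) (k : ℕ) :
    Measurable fun p : (Fin n → Fin m → Z) × (ℕ → Fin n → Fin m) =>
      meanIterate loss P η p.1 p.2 k :=
  (Finset.measurable_sum Finset.univ fun w _ =>
    h.measurable_distSGD hmeas k w).fun_const_smul (1 / (n : ℝ))

lemma IsRegularLoss.measurable_empiricalRisk (h : IsRegularLoss L β loss)
    (hmeas : ∀ x, Measurable (loss x)) {α : Type*} [MeasurableSpace α]
    {D : α → Fin n → Fin m → Z} (hD : Measurable D) {x : α → Model d} (hx : Measurable x) :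
    Measurable fun a => empiricalRisk loss (D a) (x a) :=
  (Finset.measurable_sum _ fun w _ => (Finset.measurable_sum _ fun i _ =>
    (h.measurable_uncurry_loss hmeas).comp (hx.prodMk ((measurable_pi_apply i).comp
      ((measurable_pi_apply w).comp hD)))).const_mul _).const_mul _

lemma measurable_replaceSample (i : Fin n × Fin m) :
    Measurable fun p : (Fin n → Fin m → Z) × Z => replaceSample p.1 i p.2 := by
  refine measurable_pi_lambda _ fun w => measurable_pi_lambda _ fun k => ?_
  by_cases hi : i = (w, k)
  · subst hi
    simpa [replaceSample] using measurable_snd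
  · simp only [replaceSample_of_ne _ _ hi]
    exact (measurable_pi_apply k).comp ((measurable_pi_apply w).comp measurable_fst)

lemma IsRegularLoss.lipschitz_testRisk (h : IsRegularLoss L β loss) {μ : Measure Z}
    [IsProbabilityMeasure μ] (hint : ∀ x, Integrable (loss x) μ) (x y : Model d) :
    |testRisk loss μ x - testRisk loss μ y| ≤ L * ‖x - y‖ := by
  unfold testRisk
  rw [← integral_sub (hint x) (hint y)]
  have := norm_integral_le_of_norm_le_const (μ := μ) (f := fun z => loss x z - loss y z)
    (Filter.Eventually.of_forall fun z => h.lipschitz z x y)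
  simpa using this

lemma IsRegularLoss.measurable_testRisk (h : IsRegularLoss L β loss) {μ : Measure Z}
    [IsProbabilityMeasure μ] (hint : ∀ x, Integrable (loss x) μ) :
    Measurable (testRisk loss μ) := by
  refine (LipschitzWith.of_dist_le_mul (K := L.toNNReal) fun x y => ?_).continuous.measurable
  rw [dist_eq_norm, dist_eq_norm, Real.coe_toNNReal _ h.L_nonneg]
  exact h.lipschitz_testRisk hint x y

end Measurability

/-! ### Expectations of functions of independent variables -/

section Independence

variable {Ω α γ : Type*} [MeasurableSpace Ω] [MeasurableSpace α] [MeasurableSpace γ]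
  {Pr : Measure Ω} [IsProbabilityMeasure Pr]

lemma Measurable.integrable_of_abs_le {f : Ω → ℝ} (hf : Measurable f) {C : ℝ}
    (hC : ∀ ω, |f ω| ≤ C) : Integrable f Pr :=
  Integrable.of_bound hf.aestronglyMeasurable C (Filter.Eventually.of_forall hC)

/-- For independent `A` and `B`, the expectation of a bounded function of the pair may be computed
with two independent copies of the sample space. -/
lemma integral_indepFun_eq {A : Ω → α} {B : Ω → γ} (hA : Measurable A) (hB : Measurable B)
    (hAB : IndepFun A B Pr) {H : α × γ → ℝ} (hH : Measurable H) {C : ℝ} (hC : ∀ p, |H p| ≤ C) :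
    ∫ ω, H (A ω, B ω) ∂Pr = ∫ ω, ∫ ω', H (A ω, B ω') ∂Pr ∂Pr := by
  have : IsProbabilityMeasure (Pr.map A) := Measure.isProbabilityMeasure_map hA.aemeasurable
  have : IsProbabilityMeasure (Pr.map B) := Measure.isProbabilityMeasure_map hB.aemeasurable
  rw [← integral_map (hA.prodMk hB).aemeasurable hH.aestronglyMeasurable,
    hAB.map_prod_eq_prod_map_map hA.aemeasurable hB.aemeasurable,
    integral_prod _ (hH.integrable_of_abs_le hC)]
  have h1 : ∀ a, ∫ b, H (a, b) ∂(Pr.map B) = ∫ ω', H (a, B ω') ∂Pr := fun a =>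
    integral_map hB.aemeasurable (hH.comp measurable_prodMk_left).aestronglyMeasurable
  simp only [h1]
  have h2 : StronglyMeasurable fun a => ∫ ω', H (a, B ω') ∂Pr :=
    StronglyMeasurable.integral_prod_right
      (hH.comp (measurable_fst.prodMk (hB.comp measurable_snd))).stronglyMeasurable
  exact integral_map hA.aemeasurable h2.aestronglyMeasurable

lemma integral_indepFun_le {A : Ω → α} {B : Ω → γ} (hA : Measurable A) (hB : Measurable B)
    (hAB : IndepFun A B Pr) {H : α × γ → ℝ} (hH : Measurable H) {C : ℝ} (hC : ∀ p, |H p| ≤ C)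
    {c : ℝ} (hc : ∀ᵐ ω ∂Pr, ∫ ω', H (A ω, B ω') ∂Pr ≤ c) :
    ∫ ω, H (A ω, B ω) ∂Pr ≤ c := by
  rw [integral_indepFun_eq hA hB hAB hH hC]
  have h1 : Integrable (fun p : Ω × Ω => H (A p.1, B p.2)) (Pr.prod Pr) :=
    (hH.comp ((hA.comp measurable_fst).prodMk (hB.comp measurable_snd))).integrable_of_abs_le
      fun p => hC _
  simpa using integral_mono_ae h1.integral_prod_left (integrable_const c) hc

end Independence

/-! ### The sampling model -/

section Sampling

open scoped RealInnerProductSpace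

variable {Ω Z : Type*} [MeasurableSpace Ω] [MeasurableSpace Z] {d n m : ℕ} {Pr : Measure Ω}
  {μ : Measure Z} {D : Ω → Fin n → Fin m → Z}
  {K : Ω → ℕ → Fin n → Fin m}

lemma IsSamplingModel.measurable_D (hDK : IsSamplingModel Pr μ D K) : Measurable D :=
  measurable_pi_lambda _ fun v => measurable_pi_lambda _ fun i => hDK.measurable_data v i

lemma IsSamplingModel.measurable_K (hDK : IsSamplingModel Pr μ D K) : Measurable K :=
  measurable_pi_lambda _ fun k => measurable_pi_lambda _ fun v => hDK.measurable_index k v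

variable [IsProbabilityMeasure Pr]

/-- Exchangeability of a sample with a fresh one: the pair of the data set and its `i`-th sample has
the law of the pair of the data set with the `i`-th sample replaced, and the replacement. -/
lemma IsSamplingModel.integral_data_eq (hDK : IsSamplingModel Pr μ D K) (i : Fin n × Fin m)
    {F : (Fin n → Fin m → Z) × Z → ℝ} (hF : Measurable F) {C : ℝ} (hC : ∀ p, |F p| ≤ C) :
    ∫ ω, F (D ω, D ω i.1 i.2) ∂Pr = ∫ ω, ∫ z, F (replaceSample (D ω) i z, z) ∂μ ∂Pr := by
  classical
  let S : Finset (Fin n × Fin m) := Finset.univ.erase i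
  let A : Ω → (S → Z) := fun ω p => D ω p.1.1 p.1.2
  let B : Ω → Z := fun ω => D ω i.1 i.2
  -- the data set rebuilt from the samples off `i` and a value for the sample `i`
  let rec' : (S → Z) × Z → Fin n → Fin m → Z :=
    fun q w k => if h : (w, k) ∈ S then q.1 ⟨(w, k), h⟩ else q.2
  have hA : Measurable A := measurable_pi_lambda _ fun p => hDK.measurable_data _ _
  have hB : Measurable B := hDK.measurable_data _ _
  have hrec : Measurable rec' := by
    refine measurable_pi_lambda _ fun w => measurable_pi_lambda _ fun k => ?_
    by_cases h : (w, k) ∈ S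
    · simp only [rec', h, dif_pos]
      exact (measurable_pi_apply _).comp measurable_fst
    · simp only [rec', h, dif_neg, not_false_eq_true]
      exact measurable_snd
  have hrec_eq : ∀ ω z, rec' (A ω, z) = replaceSample (D ω) i z := fun ω z => by
    funext w k
    by_cases h : i = (w, k)
    · subst h
      simp [rec', S, replaceSample]
    · have h' : (w, k) ∈ S := by simp [S, eq_comm, h]
      simp only [rec', h', dif_pos, replaceSample_of_ne _ _ h, A]
  have hAB : IndepFun A B Pr := by
    have h1 := hDK.indep_data.indepFun_finset S {i} (by simp [S])
      (fun p => hDK.measurable_data _ _)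
    exact h1.comp measurable_id (measurable_pi_apply (⟨i, by simp⟩ : ({i} : Finset _)))
  have hself : ∀ ω, replaceSample (D ω) i (B ω) = D ω := fun ω => by
    simp [replaceSample, B]
  have h2 := integral_indepFun_eq hA hB hAB (H := fun q => F (rec' q, q.2))
    (hF.comp (hrec.prodMk measurable_snd)) (fun q => hC _)
  simp only [hrec_eq, hself] at h2
  rw [h2]
  refine integral_congr_ae (Filter.Eventually.of_forall fun ω => ?_)
  dsimp only
  rw [← hDK.law_data i.1 i.2]
  have h3 : Measurable fun z => F (replaceSample (D ω) i z, z) :=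
    hF.comp (((measurable_replaceSample i).comp measurable_prodMk_left).prodMk measurable_id)
  exact (integral_map (hDK.measurable_data _ _).aemeasurable h3.aestronglyMeasurable).symm

lemma IsSamplingModel.integral_index_eq (hDK : IsSamplingModel Pr μ D K) (k : ℕ) (w : Fin n)
    (f : Fin m → ℝ) : ∫ ω, f (K ω k w) ∂Pr = 1 / (m : ℝ) * ∑ i, f i := by
  have hK := hDK.measurable_index k w
  have : IsProbabilityMeasure (Pr.map fun ω => K ω k w) :=
    Measure.isProbabilityMeasure_map hK.aemeasurable
  have h1 := integral_map (μ := Pr) hK.aemeasurable (f := f)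
    (Measurable.of_discrete).aestronglyMeasurable
  rw [← h1, integral_fintype (Integrable.of_finite), Finset.mul_sum]
  refine Finset.sum_congr rfl fun i _ => ?_
  rw [map_measureReal_apply hK (measurableSet_singleton i), smul_eq_mul]
  congr 1
  exact hDK.uniform_index k w i

/-- A quantity that depends on the sample indices before time `k` and on one index at time `k`
has mean zero if averaging over the latter index gives zero. -/
lemma IsSamplingModel.integral_eq_zero (hDK : IsSamplingModel Pr μ D K) (k : ℕ) (w : Fin n)
    {f : (ℕ → Fin n → Fin m) → Fin m → ℝ}
    (hf : ∀ K₁ K₂ : ℕ → Fin n → Fin m, (∀ j < k, K₁ j = K₂ j) → f K₁ = f K₂)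
    (hzero : ∀ K₁, ∑ i, f K₁ i = 0) :
    ∫ ω, f (K ω) (K ω k w) ∂Pr = 0 := by
  obtain ⟨ω₀⟩ := Measure.nonempty_of_neZero Pr
  let A : Ω → (Finset.range k → Fin n → Fin m) := fun ω j => K ω j
  let B : Ω → Fin m := fun ω => K ω k w
  let ext : (Finset.range k → Fin n → Fin m) → ℕ → Fin n → Fin m :=
    fun a j => if h : j ∈ Finset.range k then a ⟨j, h⟩ else K ω₀ j
  have hcoord : ∀ j, Measurable fun ω => K ω j := fun j =>
    measurable_pi_lambda _ fun v => hDK.measurable_index j v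
  have hA : Measurable A := measurable_pi_lambda _ fun j => hcoord j
  have hB : Measurable B := hDK.measurable_index k w
  have hAB : IndepFun A B Pr := by
    have h1 := hDK.indep_index.indepFun_finset (Finset.range k) {k} (by simp) hcoord
    exact h1.comp measurable_id ((measurable_pi_apply w).comp
      (measurable_pi_apply (⟨k, by simp⟩ : ({k} : Finset ℕ))))
  have hext : ∀ ω, f (ext (A ω)) = f (K ω) := fun ω => hf _ _ fun j hj => by
    simp [ext, A, hj]
  let H : (Finset.range k → Fin n → Fin m) × Fin m → ℝ := fun q => f (ext q.1) q.2
  have h2 := integral_indepFun_eq hA hB hAB (H := H) Measurable.of_discrete (C := ∑ q, |H q|)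
    fun q => Finset.single_le_sum (f := fun q => |H q|) (fun _ _ => abs_nonneg _)
      (Finset.mem_univ q)
  simp only [H, hext] at h2
  rw [h2]
  simp [B, hDK.integral_index_eq k w, hzero]

variable {loss : Model d → Z → ℝ} {L β : ℝ} {P : Matrix (Fin n) (Fin n) ℝ} {η : ℝ}

/-- For a fixed data set the gradient noise is orthogonal in mean to everything that is determined
by the past. -/
lemma IsSamplingModel.integral_inner_noise_eq_zero (hDK : IsSamplingModel Pr μ D K)
    (h : IsRegularLoss L β loss) (hm : 0 < m) (D₀ : Fin n → Fin m → Z) (k : ℕ) (w : Fin n)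
    (y : Model d) :
    ∫ ω, ⟪fullGrad loss P η D₀ (K ω) k w - stochGrad loss P η D₀ (K ω) k w,
      meanIterate loss P η D₀ (K ω) k - y⟫ ∂Pr = 0 := by
  have hm' : (m : ℝ) ≠ 0 := by positivity
  refine hDK.integral_eq_zero k w (f := fun K₁ i => ⟪fullGrad loss P η D₀ K₁ k w
    - lossGrad loss (distSGD loss P η (fun _ => 0) D₀ K₁ k w) (D₀ w i),
      meanIterate loss P η D₀ K₁ k - y⟫) (fun K₁ K₂ hK => ?_) fun K₁ => ?_
  · simp only [fullGrad, meanIterate, distSGD_congr_index _ D₀ hK]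
  · rw [← sum_inner, Finset.sum_sub_distrib, Finset.sum_const, Finset.card_univ, Fintype.card_fin,
      fullGrad, h.gradient_localRisk, ← Nat.cast_smul_eq_nsmul ℝ, smul_smul,
      mul_one_div_cancel hm', one_smul, sub_self, inner_zero_left]

end Sampling

/-! ### Generalisation error -/

section Generalisation

open scoped RealInnerProductSpace

variable {Ω Z : Type*} [MeasurableSpace Ω] [MeasurableSpace Z] {d n m : ℕ} {Pr : Measure Ω}
  {μ : Measure Z} {D : Ω → Fin n → Fin m → Z} {K : Ω → ℕ → Fin n → Fin m}
  {loss : Model d → Z → ℝ} {L β : ℝ} {P : Matrix (Fin n) (Fin n) ℝ} {η : ℝ}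

omit [MeasurableSpace Z] in
lemma empiricalRisk_sub_eq_sum (D₀ : Fin n → Fin m → Z) (x y : Model d) :
    empiricalRisk loss D₀ x - empiricalRisk loss D₀ y =
      1 / ((n : ℝ) * m) * ∑ i : Fin n × Fin m, (loss x (D₀ i.1 i.2) - loss y (D₀ i.1 i.2)) := by
  unfold empiricalRisk localRisk
  rw [Fintype.sum_prod_type, ← Finset.mul_sum, ← Finset.mul_sum]
  simp only [Finset.sum_sub_distrib]
  ring

omit [MeasurableSpace Z] in
lemma IsRegularLoss.abs_empiricalRisk_sub_le (h : IsRegularLoss L β loss) (hn : 0 < n)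
    (hm : 0 < m) (D₀ : Fin n → Fin m → Z) (x y : Model d) :
    |empiricalRisk loss D₀ x - empiricalRisk loss D₀ y| ≤ L * ‖x - y‖ := by
  have h1 := h.empiricalRisk_sub_le_norm hn hm D₀ x y
  have h2 := h.empiricalRisk_sub_le_norm hn hm D₀ y x
  rw [norm_sub_rev] at h2
  exact abs_le.2 ⟨by linarith, h1⟩

omit [MeasurableSpace Z] in
lemma IsRegularLoss.mul_norm_ergodicAverage_sub_le (h : IsRegularLoss L β loss)
    (hP : P ∈ doublyStochastic ℝ (Fin n)) (hη : 0 ≤ η) (D₀ : Fin n → Fin m → Z)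
    (K₀ : ℕ → Fin n → Fin m) {t : ℕ} (ht : 1 ≤ t) (v : Fin n) (y : Model d) :
    L * ‖ergodicAverage loss P η (fun _ => 0) D₀ K₀ t v - y‖ ≤ L * (η * L * t + ‖y‖) :=
  mul_le_mul_of_nonneg_left ((norm_sub_le _ _).trans
    (add_le_add_left (h.norm_ergodicAverage_le hP hη D₀ K₀ ht v) _)) h.L_nonneg

variable [IsProbabilityMeasure Pr] [IsProbabilityMeasure μ]

/-- The gap between the population average and the sample average of a data-dependent function.
Exchanging each sample with a fresh one turns the gap into the average effect of replacing one
sample. -/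
lemma IsSamplingModel.integral_sub_sampleMean_le (hDK : IsSamplingModel Pr μ D K) (hn : 0 < n)
    (hm : 0 < m) {F : (Fin n → Fin m → Z) → Z → ℝ} (hF : Measurable (Function.uncurry F))
    {C c : ℝ} (hC : ∀ D₀ z, |F D₀ z| ≤ C)
    (hc : ∀ D₀ z, ∑ i : Fin n × Fin m, (F D₀ z - F (replaceSample D₀ i z) z) ≤ c) :
    ∫ ω, (∫ z, F (D ω) z ∂μ
      - 1 / ((n : ℝ) * m) * ∑ i : Fin n × Fin m, F (D ω) (D ω i.1 i.2)) ∂Pr ≤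
      1 / ((n : ℝ) * m) * c := by
  have hDm := hDK.measurable_D
  have hΦ : Integrable (fun ω => ∫ z, F (D ω) z ∂μ) Pr := by
    have : Measurable fun p : Ω × Z => F (D p.1) p.2 :=
      hF.comp ((hDm.comp measurable_fst).prodMk measurable_snd)
    exact (this.integrable_of_abs_le (Pr := Pr.prod μ) fun p => hC _ _).integral_prod_left
  have hrepl : ∀ i, Measurable fun p : (Fin n → Fin m → Z) × Z =>
      F (replaceSample p.1 i p.2) p.2 := fun i =>
    hF.comp ((measurable_replaceSample i).prodMk measurable_snd)
  have hΨ : ∀ i, Integrable (fun ω => ∫ z, F (replaceSample (D ω) i z) z ∂μ) Pr := fun i => by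
    have : Measurable fun p : Ω × Z => F (replaceSample (D p.1) i p.2) p.2 :=
      (hrepl i).comp ((hDm.comp measurable_fst).prodMk measurable_snd)
    exact (this.integrable_of_abs_le (Pr := Pr.prod μ) fun p => hC _ _).integral_prod_left
  have hS : ∀ i : Fin n × Fin m, Integrable (fun ω => F (D ω) (D ω i.1 i.2)) Pr := fun i => by
    have : Measurable fun ω => F (D ω) (D ω i.1 i.2) :=
      hF.comp (hDm.prodMk (hDK.measurable_data i.1 i.2))
    exact this.integrable_of_abs_le fun ω => hC _ _
  have hswap : ∀ i : Fin n × Fin m, ∫ ω, F (D ω) (D ω i.1 i.2) ∂Pr =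
      ∫ ω, ∫ z, F (replaceSample (D ω) i z) z ∂μ ∂Pr := fun i =>
    hDK.integral_data_eq i hF fun p => hC _ _
  have hpoint : ∀ ω, ∫ z, F (D ω) z ∂μ
      - 1 / ((n : ℝ) * m) * ∑ i, ∫ z, F (replaceSample (D ω) i z) z ∂μ ≤
      1 / ((n : ℝ) * m) * c := fun ω => by
    have hi1 : Integrable (fun z => F (D ω) z) μ := by
      have : Measurable fun z => F (D ω) z := hF.comp measurable_prodMk_left
      exact this.integrable_of_abs_le fun z => hC _ _
    have hi2 : ∀ i, Integrable (fun z => F (replaceSample (D ω) i z) z) μ := fun i => by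
      have : Measurable fun z => F (replaceSample (D ω) i z) z :=
        (hrepl i).comp measurable_prodMk_left
      exact this.integrable_of_abs_le fun z => hC _ _
    have e : ∫ z, F (D ω) z ∂μ
        - 1 / ((n : ℝ) * m) * ∑ i, ∫ z, F (replaceSample (D ω) i z) z ∂μ =
        ∫ z, 1 / ((n : ℝ) * m) * ∑ i : Fin n × Fin m,
          (F (D ω) z - F (replaceSample (D ω) i z) z) ∂μ := by
      have hi3 : ∀ i, Integrable (fun z => F (D ω) z - F (replaceSample (D ω) i z) z) μ :=
        fun i => hi1.sub (hi2 i)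
      rw [integral_const_mul, integral_finsetSum _ fun i _ => hi3 i]
      simp only [integral_sub hi1 (hi2 _), Finset.sum_sub_distrib, Finset.sum_const,
        Finset.card_univ, Fintype.card_prod, Fintype.card_fin, nsmul_eq_mul]
      push_cast
      field_simp
    rw [e]
    exact (integral_mono ((integrable_finsetSum _ fun i _ => hi1.sub (hi2 i)).const_mul _)
      (integrable_const (1 / ((n : ℝ) * m) * c)) fun z =>
        mul_le_mul_of_nonneg_left (hc _ _) (by positivity)).trans_eq (by simp)
  calc _ = ∫ ω, (∫ z, F (D ω) z ∂μ
          - 1 / ((n : ℝ) * m) * ∑ i, ∫ z, F (replaceSample (D ω) i z) z ∂μ) ∂Pr := by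
        rw [integral_sub hΦ ((integrable_finsetSum _ fun i _ => hS i).const_mul _),
          integral_sub hΦ ((integrable_finsetSum _ fun i _ => hΨ i).const_mul _),
          integral_const_mul, integral_const_mul, integral_finsetSum _ fun i _ => hS i,
          integral_finsetSum _ fun i _ => hΨ i]
        simp only [hswap]
    _ ≤ _ := (integral_mono (hΦ.sub ((integrable_finsetSum _ fun i _ => hΨ i).const_mul _))
        (integrable_const (1 / ((n : ℝ) * m) * c)) hpoint).trans_eq (by simp)

/-- The generalisation error for a fixed realisation of the sample indices. -/
lemma IsSamplingModel.integral_generalisation_error_le_of_index (hDK : IsSamplingModel Pr μ D K)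
    (h : IsRegularLoss L β loss) (hmeas : ∀ x, Measurable (loss x))
    (hint : ∀ x, Integrable (loss x) μ) (hm : 0 < m) (hP : P ∈ doublyStochastic ℝ (Fin n))
    (hη : 0 ≤ η) (hηβ : η * β ≤ 2) (K₀ : ℕ → Fin n → Fin m) {t : ℕ} (ht : 1 ≤ t) (v : Fin n)
    (y : Model d) :
    ∫ ω, ((testRisk loss μ (ergodicAverage loss P η (fun _ => 0) (D ω) K₀ t v)
        - testRisk loss μ y)
      - (empiricalRisk loss (D ω) (ergodicAverage loss P η (fun _ => 0) (D ω) K₀ t v)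
        - empiricalRisk loss (D ω) y)) ∂Pr ≤
      1 / ((n : ℝ) * m) * (L * (η * L * (t + 1))) := by
  have hA : Measurable fun D₀ : Fin n → Fin m → Z =>
      ergodicAverage loss P η (fun _ => 0) D₀ K₀ t v :=
    ((h.measurable_ergodicAverage (P := P) (η := η) hmeas t v).comp measurable_prodMk_right :)
  have htest : ∀ x, testRisk loss μ x - testRisk loss μ y = ∫ z, (loss x z - loss y z) ∂μ :=
    fun x => (integral_sub (hint x) (hint y)).symm
  simp only [htest, empiricalRisk_sub_eq_sum]
  refine hDK.integral_sub_sampleMean_le v.pos hm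
    (F := fun D₀ z => loss (ergodicAverage loss P η (fun _ => 0) D₀ K₀ t v) z - loss y z)
    (((h.measurable_uncurry_loss hmeas).comp
      ((hA.comp measurable_fst).prodMk measurable_snd)).sub ((hmeas y).comp measurable_snd))
    (fun D₀ z => (h.lipschitz z _ _).trans
      (h.mul_norm_ergodicAverage_sub_le hP hη D₀ K₀ ht v y)) fun D₀ z => ?_
  refine le_trans ?_ (mul_le_mul_of_nonneg_left
    (h.sum_norm_ergodicAverage_replaceSample_le hP hη hηβ (fun _ => 0) D₀ z K₀ ht v) h.L_nonneg)
  rw [Finset.mul_sum]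
  refine Finset.sum_le_sum fun i _ => ?_
  rw [sub_sub_sub_cancel_right]
  exact (le_abs_self _).trans (h.lipschitz z _ _)

/-- The generalisation error, centred at a reference model `y` so that only differences of losses,
which are bounded, have to be integrated. -/
lemma IsSamplingModel.integral_generalisation_error_le (hDK : IsSamplingModel Pr μ D K)
    (h : IsRegularLoss L β loss) (hmeas : ∀ x, Measurable (loss x))
    (hint : ∀ x, Integrable (loss x) μ) (hm : 0 < m) (hP : P ∈ doublyStochastic ℝ (Fin n))
    (hη : 0 ≤ η) (hηβ : η * β ≤ 2) {t : ℕ} (ht : 1 ≤ t) (v : Fin n) (y : Model d) :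
    ∫ ω, ((testRisk loss μ (ergodicAverage loss P η (fun _ => 0) (D ω) (K ω) t v)
        - testRisk loss μ y)
      - (empiricalRisk loss (D ω) (ergodicAverage loss P η (fun _ => 0) (D ω) (K ω) t v)
        - empiricalRisk loss (D ω) y)) ∂Pr ≤
      1 / ((n : ℝ) * m) * (L * (η * L * (t + 1))) := by
  have hA : Measurable fun p : (ℕ → Fin n → Fin m) × (Fin n → Fin m → Z) =>
      ergodicAverage loss P η (fun _ => 0) p.2 p.1 t v :=
    ((h.measurable_ergodicAverage (P := P) (η := η) hmeas t v).comp
      (measurable_snd.prodMk measurable_fst) :)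
  refine integral_indepFun_le (C := L * (η * L * t + ‖y‖) + L * (η * L * t + ‖y‖))
    hDK.measurable_K hDK.measurable_D hDK.indep_data_index.symm
    (H := fun p => (testRisk loss μ (ergodicAverage loss P η (fun _ => 0) p.2 p.1 t v)
        - testRisk loss μ y)
      - (empiricalRisk loss p.2 (ergodicAverage loss P η (fun _ => 0) p.2 p.1 t v)
        - empiricalRisk loss p.2 y)) ?_ (fun p => ?_)
    (Filter.Eventually.of_forall fun ω =>
      hDK.integral_generalisation_error_le_of_index h hmeas hint hm hP hη hηβ (K ω) ht v y)
  · exact (((h.measurable_testRisk hint).comp hA).sub_const _).sub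
      ((h.measurable_empiricalRisk hmeas measurable_snd hA).sub
        (h.measurable_empiricalRisk hmeas measurable_snd measurable_const))
  · have h1 := h.mul_norm_ergodicAverage_sub_le hP hη p.2 p.1 ht v y
    exact (abs_sub _ _).trans (add_le_add ((h.lipschitz_testRisk hint _ _).trans h1)
      ((h.abs_empiricalRisk_sub_le v.pos hm _ _ _).trans h1))

end Generalisation

/-! ### Optimisation error in expectation -/

section Optimisation

open scoped RealInnerProductSpace

variable {Ω Z : Type*} [MeasurableSpace Ω] [MeasurableSpace Z] {d n m : ℕ} {Pr : Measure Ω}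
  {μ : Measure Z} {D : Ω → Fin n → Fin m → Z} {K : Ω → ℕ → Fin n → Fin m}
  {loss : Model d → Z → ℝ} {L β : ℝ} {P : Matrix (Fin n) (Fin n) ℝ} {η : ℝ}

omit [MeasurableSpace Z] in
lemma IsRegularLoss.norm_meanIterate_le (h : IsRegularLoss L β loss) (hn : 0 < n)
    (hP : P ∈ doublyStochastic ℝ (Fin n)) (hη : 0 ≤ η) (D₀ : Fin n → Fin m → Z)
    (K₀ : ℕ → Fin n → Fin m) (k : ℕ) : ‖meanIterate loss P η D₀ K₀ k‖ ≤ η * L * k := by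
  unfold meanIterate
  rw [norm_smul, Real.norm_of_nonneg (by positivity)]
  have h1 : ‖∑ w, distSGD loss P η (fun _ => 0) D₀ K₀ k w‖ ≤ ∑ _w : Fin n, η * L * k :=
    norm_sum_le_of_le _ fun w _ => h.norm_distSGD_zero_le hP hη D₀ K₀ k w
  calc 1 / (n : ℝ) * ‖∑ w, distSGD loss P η (fun _ => 0) D₀ K₀ k w‖
      ≤ 1 / (n : ℝ) * ∑ _w : Fin n, η * L * k := by gcongr
    _ = η * L * k := by simp; field_simp

omit [MeasurableSpace Z] in
lemma IsRegularLoss.norm_noise_le (h : IsRegularLoss L β loss) (D₀ : Fin n → Fin m → Z)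
    (K₀ : ℕ → Fin n → Fin m) (k : ℕ) (w : Fin n) :
    ‖stochGrad loss P η D₀ K₀ k w - fullGrad loss P η D₀ K₀ k w‖ ≤ 2 * L :=
  (norm_sub_le _ _).trans (by
    have h1 := h.norm_lossGrad_le (distSGD loss P η (fun _ => 0) D₀ K₀ k w) (D₀ w (K₀ k w))
    have h2 := h.norm_gradient_localRisk_le D₀ w (distSGD loss P η (fun _ => 0) D₀ K₀ k w)
    unfold stochGrad fullGrad
    linarith)

omit [MeasurableSpace Z] in
lemma IsRegularLoss.norm_disagreement_le (h : IsRegularLoss L β loss)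
    (hP : P ∈ doublyStochastic ℝ (Fin n)) (hη : 0 ≤ η) (D₀ : Fin n → Fin m → Z)
    (K₀ : ℕ → Fin n → Fin m) (k : ℕ) (w : Fin n) :
    ‖distSGD loss P η (fun _ => 0) D₀ K₀ k w - meanIterate loss P η D₀ K₀ k‖ ≤
      2 * (η * L * k) :=
  (norm_sub_le _ _).trans (by
    have h1 := h.norm_distSGD_zero_le hP hη D₀ K₀ k w
    have h2 := h.norm_meanIterate_le w.pos hP hη D₀ K₀ k
    linarith)

lemma IsRegularLoss.measurable_disagreement (h : IsRegularLoss L β loss)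
    (hmeas : ∀ x, Measurable (loss x)) (k : ℕ) (w : Fin n) :
    Measurable fun p : (Fin n → Fin m → Z) × (ℕ → Fin n → Fin m) =>
      ‖distSGD loss P η (fun _ => 0) p.1 p.2 k w - meanIterate loss P η p.1 p.2 k‖ :=
  ((h.measurable_distSGD hmeas k w).sub (h.measurable_meanIterate hmeas k)).norm

lemma IsRegularLoss.measurable_noise (h : IsRegularLoss L β loss)
    (hmeas : ∀ x, Measurable (loss x)) (k : ℕ) (w : Fin n) :
    Measurable fun p : (Fin n → Fin m → Z) × (ℕ → Fin n → Fin m) =>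
      ‖stochGrad loss P η p.1 p.2 k w - fullGrad loss P η p.1 p.2 k w‖ :=
  ((h.measurable_stochGrad hmeas k w).sub (h.measurable_fullGrad hmeas k w)).norm

lemma IsRegularLoss.measurable_trajectoryResidual (h : IsRegularLoss L β loss)
    (hmeas : ∀ x, Measurable (loss x)) (ρ : ℝ) (v : Fin n) (k : ℕ) :
    Measurable fun p : (Fin n → Fin m → Z) × (ℕ → Fin n → Fin m) =>
      trajectoryResidual loss P L β ρ η p.1 p.2 v k :=
  ((((Finset.measurable_sum _ fun w _ =>
      (h.measurable_noise hmeas k w).pow_const 2).const_mul _).const_mul _).add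
    (((Finset.measurable_sum _ fun w _ =>
      (h.measurable_disagreement hmeas k w).pow_const 2).const_mul _).const_mul _)).add
    ((h.measurable_disagreement hmeas (k + 1) v).const_mul _)

omit [MeasurableSpace Z] in
lemma IsRegularLoss.abs_trajectoryResidual_le (h : IsRegularLoss L β loss)
    (hP : P ∈ doublyStochastic ℝ (Fin n)) (hη : 0 ≤ η) {ρ : ℝ} (hρ : 0 < ρ)
    (D₀ : Fin n → Fin m → Z) (K₀ : ℕ → Fin n → Fin m) (v : Fin n) (k : ℕ) :
    |trajectoryResidual loss P L β ρ η D₀ K₀ v k| ≤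
      ρ / 2 * (1 / (n : ℝ) * ∑ _w : Fin n, (2 * L) ^ 2)
      + β / 2 * (1 / (n : ℝ) * ∑ _w : Fin n, (2 * (η * L * k)) ^ 2)
      + L * (2 * (η * L * (k + 1 : ℕ))) := by
  have hβ := h.β_pos
  have hL := h.L_nonneg
  unfold trajectoryResidual
  rw [abs_of_nonneg (by positivity)]
  gcongr with w _ w _
  · exact h.norm_noise_le D₀ K₀ k w
  · exact h.norm_disagreement_le hP hη D₀ K₀ k w
  · exact h.norm_disagreement_le hP hη D₀ K₀ (k + 1) v

variable [IsProbabilityMeasure Pr]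

/-- The optimisation error, centred at a reference model `y`. Conditionally on the data the
minimiser of the empirical risk is a constant, so no measurability of it is needed: for almost every
fixed data set the inner products with the gradient noise have mean zero. -/
lemma IsSamplingModel.integral_optimisation_error_le (hDK : IsSamplingModel Pr μ D K)
    (h : IsRegularLoss L β loss) (hmeas : ∀ x, Measurable (loss x))
    (hm : 0 < m) (hP : P ∈ doublyStochastic ℝ (Fin n)) {ρ : ℝ} (hρ : 0 < ρ)
    (hη : η = 1 / (β + 1 / ρ)) {t : ℕ} (ht : 1 ≤ t) (v : Fin n) (y : Model d)
    {Xstar : (Fin n → Fin m → Z) → Model d} {G : ℝ}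
    (hXstar : ∀ᵐ ω ∂Pr, ∀ x, empiricalRisk loss (D ω) (Xstar (D ω)) ≤ empiricalRisk loss (D ω) x)
    (hG : ∀ᵐ ω ∂Pr, ‖Xstar (D ω)‖ ≤ G) :
    ∫ ω, (empiricalRisk loss (D ω) (ergodicAverage loss P η (fun _ => 0) (D ω) (K ω) t v)
        - empiricalRisk loss (D ω) y
        - 1 / (t : ℝ) * ∑ k ∈ Finset.range t,
            trajectoryResidual loss P L β ρ η (D ω) (K ω) v k) ∂Pr ≤
      (β + 1 / ρ) * G ^ 2 / (2 * t) := by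
  have hβ := h.β_pos
  have hη0 : 0 ≤ η := by rw [hη]; positivity
  let B : ℕ → ℝ := fun k => ρ / 2 * (1 / (n : ℝ) * ∑ _w : Fin n, (2 * L) ^ 2)
      + β / 2 * (1 / (n : ℝ) * ∑ _w : Fin n, (2 * (η * L * k)) ^ 2)
      + L * (2 * (η * L * (k + 1 : ℕ)))
  let H : (Fin n → Fin m → Z) × (ℕ → Fin n → Fin m) → ℝ := fun p =>
    empiricalRisk loss p.1 (ergodicAverage loss P η (fun _ => 0) p.1 p.2 t v)
        - empiricalRisk loss p.1 y
        - 1 / (t : ℝ) * ∑ k ∈ Finset.range t, trajectoryResidual loss P L β ρ η p.1 p.2 v k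
  have hHm : Measurable H :=
    ((h.measurable_empiricalRisk hmeas measurable_fst (h.measurable_ergodicAverage hmeas t v)).sub
      (h.measurable_empiricalRisk hmeas measurable_fst measurable_const)).sub
      ((Finset.measurable_sum _ fun k _ =>
        h.measurable_trajectoryResidual hmeas ρ v k).const_mul _)
  have hHC : ∀ p, |H p| ≤
      L * (η * L * t + ‖y‖) + 1 / (t : ℝ) * ∑ k ∈ Finset.range t, B k := fun p => by
    refine (abs_sub _ _).trans (add_le_add ((h.abs_empiricalRisk_sub_le v.pos hm _ _ _).trans
      (h.mul_norm_ergodicAverage_sub_le hP hη0 p.1 p.2 ht v y)) ?_)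
    rw [abs_mul, abs_of_nonneg (by positivity : (0 : ℝ) ≤ 1 / t)]
    refine mul_le_mul_of_nonneg_left ((Finset.abs_sum_le_sum_abs _ _).trans
      (Finset.sum_le_sum fun k _ => ?_)) (by positivity)
    exact h.abs_trajectoryResidual_le hP hη0 hρ p.1 p.2 v k
  refine integral_indepFun_le hDK.measurable_D hDK.measurable_K hDK.indep_data_index hHm hHC ?_
  filter_upwards [hXstar, hG] with ω hmin hbound
  set D₀ := D ω
  set x := Xstar D₀
  have hKm : Measurable fun ω' => (D₀, K ω') := measurable_prodMk_left.comp hDK.measurable_K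
  have hI : ∀ k w, Integrable (fun ω' => ⟪fullGrad loss P η D₀ (K ω') k w
      - stochGrad loss P η D₀ (K ω') k w, meanIterate loss P η D₀ (K ω') k - x⟫) Pr :=
    fun k w => by
    have hmI : Measurable fun ω' => ⟪fullGrad loss P η D₀ (K ω') k w
        - stochGrad loss P η D₀ (K ω') k w, meanIterate loss P η D₀ (K ω') k - x⟫ :=
      (((h.measurable_fullGrad hmeas k w).comp hKm).sub
        ((h.measurable_stochGrad hmeas k w).comp hKm)).inner
        (((h.measurable_meanIterate hmeas k).comp hKm).sub_const x)
    refine hmI.integrable_of_abs_le (C := 2 * L * (η * L * k + ‖x‖)) fun ω' => ?_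
    refine (abs_real_inner_le_norm _ _).trans ?_
    have h1 := h.norm_noise_le (P := P) (η := η) D₀ (K ω') k w
    have h2 := h.norm_meanIterate_le v.pos hP hη0 D₀ (K ω') k
    have hL := h.L_nonneg
    rw [norm_sub_rev] at h1
    gcongr
    exact (norm_sub_le _ _).trans (by gcongr)
  have hpoint : ∀ ω', H (D₀, K ω') ≤ (β + 1 / ρ) * G ^ 2 / (2 * t)
      + 1 / (t : ℝ) * ∑ k ∈ Finset.range t, 1 / (n : ℝ) * ∑ w,
        ⟪fullGrad loss P η D₀ (K ω') k w - stochGrad loss P η D₀ (K ω') k w,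
          meanIterate loss P η D₀ (K ω') k - x⟫ := fun ω' => by
    have h1 := h.empiricalRisk_ergodicAverage_sub_le hm hP hρ hη D₀ (K ω') ht v hbound
    have h2 := hmin y
    simp only [inner_smul_left, sum_inner, conj_trivial] at h1
    simp only [H]
    linarith
  have hIsum : Integrable (fun ω' => 1 / (t : ℝ) * ∑ k ∈ Finset.range t, 1 / (n : ℝ) * ∑ w,
        ⟪fullGrad loss P η D₀ (K ω') k w - stochGrad loss P η D₀ (K ω') k w,
          meanIterate loss P η D₀ (K ω') k - x⟫) Pr :=
    (integrable_finsetSum _ fun k _ =>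
      (integrable_finsetSum _ fun w _ => hI k w).const_mul _).const_mul _
  refine (integral_mono ((hHm.comp hKm).integrable_of_abs_le fun ω' => hHC _)
    ((integrable_const _).add hIsum) hpoint).trans_eq ?_
  rw [integral_add' (integrable_const _) hIsum, integral_const_mul,
    integral_finsetSum _ fun k _ => (integrable_finsetSum _ fun w _ => hI k w).const_mul _]
  have hzero : ∀ k, ∫ ω', 1 / (n : ℝ) * ∑ w,
        ⟪fullGrad loss P η D₀ (K ω') k w - stochGrad loss P η D₀ (K ω') k w,
          meanIterate loss P η D₀ (K ω') k - x⟫ ∂Pr = 0 := fun k => by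
    rw [integral_const_mul, integral_finsetSum _ fun w _ => hI k w]
    simp [hDK.integral_inner_noise_eq_zero h hm D₀ k _ x]
  rw [Finset.sum_eq_zero fun k _ => hzero k]
  simp

/-- Second moment of the disagreement of the nodes: the weighted Cauchy–Schwarz inequality reduces
it to the second moments of the centred gradients and the total deviation of the rows of the powers
of `P` from uniform. -/
lemma IsSamplingModel.integral_disagreement_sq_le (hDK : IsSamplingModel Pr μ D K)
    (h : IsRegularLoss L β loss) (hmeas : ∀ x, Measurable (loss x))
    (hP : P ∈ doublyStochastic ℝ (Fin n)) (hη : 0 ≤ η) {κ M : ℝ}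
    (hdev : ∀ w k, ∫ ω, ‖stochGrad loss P η (D ω) (K ω) k w
      - (1 / (n : ℝ)) • ∑ u, fullGrad loss P η (D ω) (K ω) k u‖ ^ 2 ∂Pr ≤ κ ^ 2)
    (v : Fin n) (k : ℕ)
    (hM : ∑ j ∈ Finset.range k, ∑ w, |(P ^ (j + 1)) v w - 1 / (n : ℝ)| ≤ M) :
    ∫ ω, ‖distSGD loss P η (fun _ => 0) (D ω) (K ω) k v
      - meanIterate loss P η (D ω) (K ω) k‖ ^ 2 ∂Pr ≤ (η * κ * M) ^ 2 := by
  let I := Finset.range k ×ˢ (Finset.univ : Finset (Fin n))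
  let a : ℕ × Fin n → ℝ := fun i => |(P ^ (k - i.1)) v i.2 - 1 / (n : ℝ)|
  let c : ℕ → Ω → Model d := fun j ω => (1 / (n : ℝ)) • ∑ u, fullGrad loss P η (D ω) (K ω) j u
  let ξ : ℕ × Fin n → Ω → ℝ := fun i ω => ‖stochGrad loss P η (D ω) (K ω) i.1 i.2 - c i.1 ω‖
  have hDKm : Measurable fun ω => (D ω, K ω) := hDK.measurable_D.prodMk hDK.measurable_K
  have ha : ∀ i, 0 ≤ a i := fun i => abs_nonneg _
  have haM : ∑ i ∈ I, a i ≤ M := by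
    refine le_trans (le_of_eq ?_) hM
    rw [Finset.sum_product, ← Finset.sum_range_reflect]
    refine Finset.sum_congr rfl fun j hj => Finset.sum_congr rfl fun w _ => ?_
    have hj' := Finset.mem_range.1 hj
    have e : k - (k - 1 - j) = j + 1 := by omega
    simp only [a, e]
  have hξm : ∀ i, Measurable (ξ i) := fun i =>
    (((h.measurable_stochGrad hmeas i.1 i.2).comp hDKm).sub
      (Measurable.fun_const_smul (Finset.measurable_sum Finset.univ fun u _ =>
        (h.measurable_fullGrad hmeas i.1 u).comp hDKm) (1 / (n : ℝ)))).norm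
  have hξb : ∀ i ω, ξ i ω ≤ L + 1 / (n : ℝ) * ∑ _u : Fin n, L := fun i ω => by
    refine (norm_sub_le _ _).trans (add_le_add (h.norm_lossGrad_le _ _) ?_)
    rw [norm_smul, Real.norm_of_nonneg (by positivity)]
    exact mul_le_mul_of_nonneg_left (norm_sum_le_of_le _ fun u _ =>
      h.norm_gradient_localRisk_le _ u _) (by positivity)
  have hξi : ∀ i, Integrable (fun ω => ξ i ω ^ 2) Pr := fun i =>
    ((hξm i).pow_const 2).integrable_of_abs_le (C := (L + 1 / (n : ℝ) * ∑ _u : Fin n, L) ^ 2)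
      fun ω => by
        rw [abs_of_nonneg (sq_nonneg _)]
        exact pow_le_pow_left₀ (norm_nonneg _) (hξb i ω) 2
  have hpoint : ∀ ω, ‖distSGD loss P η (fun _ => 0) (D ω) (K ω) k v
      - meanIterate loss P η (D ω) (K ω) k‖ ^ 2 ≤
      η ^ 2 * ((∑ i ∈ I, a i) * ∑ i ∈ I, a i * ξ i ω ^ 2) := fun ω => by
    have h1 := norm_distSGD_sub_meanIterate_le (loss := loss) hP hη (D ω) (K ω)
      (fun j => c j ω) k v
    rw [← Finset.sum_product' (Finset.range k) Finset.univ
      (fun j w => |(P ^ (k - j)) v w - 1 / (n : ℝ)| *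
        ‖stochGrad loss P η (D ω) (K ω) j w - c j ω‖)] at h1
    refine (pow_le_pow_left₀ (norm_nonneg _) h1 2).trans ?_
    rw [mul_pow]
    refine mul_le_mul_of_nonneg_left ?_ (sq_nonneg _)
    refine Finset.sum_sq_le_sum_mul_sum_of_sq_le_mul I (fun i _ => ha i)
      (fun i _ => mul_nonneg (ha i) (sq_nonneg _)) fun i _ => ?_
    exact le_of_eq (by simp only [a, ξ]; ring)
  have hS : 0 ≤ ∑ i ∈ I, a i := Finset.sum_nonneg fun i _ => ha i
  calc _ ≤ ∫ ω, η ^ 2 * ((∑ i ∈ I, a i) * ∑ i ∈ I, a i * ξ i ω ^ 2) ∂Pr := by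
        refine integral_mono_of_nonneg (Filter.Eventually.of_forall fun ω => sq_nonneg _)
          (((integrable_finsetSum _ fun i _ => (hξi i).const_mul _).const_mul _).const_mul _)
          (Filter.Eventually.of_forall hpoint)
    _ = η ^ 2 * ((∑ i ∈ I, a i) * ∑ i ∈ I, a i * ∫ ω, ξ i ω ^ 2 ∂Pr) := by
        rw [integral_const_mul, integral_const_mul,
          integral_finsetSum _ fun i _ => (hξi i).const_mul _]
        simp only [integral_const_mul]
    _ ≤ η ^ 2 * ((∑ i ∈ I, a i) * ∑ i ∈ I, a i * κ ^ 2) := by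
        gcongr with i _
        exact hdev i.2 i.1
    _ = (η * κ * ∑ i ∈ I, a i) ^ 2 := by rw [← Finset.sum_mul]; ring
    _ ≤ (η * κ * M) ^ 2 := by
        simp only [mul_pow]
        gcongr

/-- A second moment of at most `a ^ 2` bounds the mean by `a`. -/
lemma integral_le_of_integral_sq_le {f : Ω → ℝ} (hf : Integrable f Pr)
    (hf2 : Integrable (fun ω => f ω ^ 2) Pr) {a : ℝ} (ha : 0 < a)
    (h : ∫ ω, f ω ^ 2 ∂Pr ≤ a ^ 2) : ∫ ω, f ω ∂Pr ≤ a := by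
  have h1 : ∫ ω, f ω ∂Pr ≤ ∫ ω, (1 / (2 * a) * f ω ^ 2 + a / 2) ∂Pr := by
    refine integral_mono hf ((hf2.const_mul _).add (integrable_const _)) fun ω => ?_
    have : 0 ≤ 1 / (2 * a) * (f ω - a) ^ 2 := by positivity
    have e : 1 / (2 * a) * (f ω - a) ^ 2 = 1 / (2 * a) * f ω ^ 2 + a / 2 - f ω := by
      field_simp; ring
    linarith
  refine h1.trans ?_
  rw [integral_add (hf2.const_mul _) (integrable_const _), integral_const_mul, integral_const]
  calc 1 / (2 * a) * ∫ ω, f ω ^ 2 ∂Pr + Pr.real Set.univ • (a / 2)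
      ≤ 1 / (2 * a) * a ^ 2 + a / 2 := by simp only [probReal_univ, one_smul]; gcongr
    _ = a := by field_simp; ring

/-- The expected residual in terms of the variance bound `σ ^ 2` and of a bound `a ^ 2` on the
second moments of the disagreement. -/
lemma IsSamplingModel.integral_trajectoryResidual_le (hDK : IsSamplingModel Pr μ D K)
    (h : IsRegularLoss L β loss) (hmeas : ∀ x, Measurable (loss x))
    (hP : P ∈ doublyStochastic ℝ (Fin n)) (hη : 0 ≤ η) {ρ σ a : ℝ} (hρ : 0 < ρ) (ha : 0 < a)
    (v : Fin n) (k : ℕ)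
    (hvar : ∀ w, ∫ ω, ‖stochGrad loss P η (D ω) (K ω) k w
      - fullGrad loss P η (D ω) (K ω) k w‖ ^ 2 ∂Pr ≤ σ ^ 2)
    (hnet : ∀ w, ∫ ω, ‖distSGD loss P η (fun _ => 0) (D ω) (K ω) k w
      - meanIterate loss P η (D ω) (K ω) k‖ ^ 2 ∂Pr ≤ a ^ 2)
    (hnet' : ∫ ω, ‖distSGD loss P η (fun _ => 0) (D ω) (K ω) (k + 1) v
      - meanIterate loss P η (D ω) (K ω) (k + 1)‖ ^ 2 ∂Pr ≤ a ^ 2) :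
    ∫ ω, trajectoryResidual loss P L β ρ η (D ω) (K ω) v k ∂Pr ≤
      ρ / 2 * σ ^ 2 + β / 2 * a ^ 2 + L * a := by
  have hn := v.pos
  have hn' : (n : ℝ) ≠ 0 := by positivity
  have hβ := h.β_pos
  have hL := h.L_nonneg
  have hDKm : Measurable fun ω => (D ω, K ω) := hDK.measurable_D.prodMk hDK.measurable_K
  have hi1 : ∀ w, Integrable (fun ω => ‖stochGrad loss P η (D ω) (K ω) k w
      - fullGrad loss P η (D ω) (K ω) k w‖ ^ 2) Pr := fun w =>
    (((h.measurable_noise hmeas k w).comp hDKm).pow_const 2).integrable_of_abs_le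
      (C := (2 * L) ^ 2) fun ω => by
        rw [abs_of_nonneg (sq_nonneg _)]
        exact pow_le_pow_left₀ (norm_nonneg _) (h.norm_noise_le _ _ _ _) 2
  have hi2 : ∀ j w, Integrable (fun ω => ‖distSGD loss P η (fun _ => 0) (D ω) (K ω) j w
      - meanIterate loss P η (D ω) (K ω) j‖ ^ 2) Pr := fun j w =>
    (((h.measurable_disagreement hmeas j w).comp hDKm).pow_const 2).integrable_of_abs_le
      (C := (2 * (η * L * j)) ^ 2) fun ω => by
        rw [abs_of_nonneg (sq_nonneg _)]
        exact pow_le_pow_left₀ (norm_nonneg _) (h.norm_disagreement_le hP hη _ _ _ _) 2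
  have hi3 : Integrable (fun ω => ‖distSGD loss P η (fun _ => 0) (D ω) (K ω) (k + 1) v
      - meanIterate loss P η (D ω) (K ω) (k + 1)‖) Pr :=
    ((h.measurable_disagreement hmeas (k + 1) v).comp hDKm).integrable_of_abs_le
      (C := 2 * (η * L * (k + 1 : ℕ))) fun ω =>
        (abs_norm _).trans_le (h.norm_disagreement_le hP hη _ _ _ _)
  have hmean : ∀ {f : Fin n → ℝ} {b : ℝ}, (∀ w, f w ≤ b) → 1 / (n : ℝ) * ∑ w, f w ≤ b :=
    fun {f b} hfb => by
      calc 1 / (n : ℝ) * ∑ w, f w ≤ 1 / (n : ℝ) * ∑ _w : Fin n, b := by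
            gcongr with w; exact hfb w
        _ = b := by simp [hn']
  unfold trajectoryResidual
  have hj1 := ((integrable_finsetSum Finset.univ fun w _ => hi1 w).const_mul
    (1 / (n : ℝ))).const_mul (ρ / 2)
  have hj2 := ((integrable_finsetSum Finset.univ fun w _ => hi2 k w).const_mul
    (1 / (n : ℝ))).const_mul (β / 2)
  rw [integral_add (by exact hj1.add hj2) (hi3.const_mul L), integral_add hj1 hj2]
  simp only [integral_const_mul]
  rw [integral_finsetSum _ fun w _ => hi1 w, integral_finsetSum _ fun w _ => hi2 k w]
  have h3 := integral_le_of_integral_sq_le hi3 (hi2 (k + 1) v) ha hnet'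
  gcongr
  · exact hmean hvar
  · exact hmean hnet

end Optimisation

/-! ### The test error bound -/

theorem mainTheorem1 {Ω Z : Type*} [MeasurableSpace Ω] [MeasurableSpace Z]
    {d n m : ℕ} (Pr : Measure Ω) [IsProbabilityMeasure Pr] (μ : Measure Z) [IsProbabilityMeasure μ]
    -- the communication matrix
    (graph : SimpleGraph (Fin n)) (P : Matrix (Fin n) (Fin n) ℝ)
    (hP : P ∈ doublyStochastic ℝ (Fin n)) (hgraph : SupportedOn P graph)
    (hnormal : P * P.transpose = P.transpose * P) (hgap : secondEigenvalueModulus P < 1)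
    -- the loss
    (loss : Model d → Z → ℝ) (L β : ℝ) (hL : 0 < L) (hβ : 0 < β)
    (hmeas : ∀ x, Measurable (loss x)) (hint : ∀ x, Integrable (loss x) μ)
    (hconvex : ∀ z, ConvexOn ℝ Set.univ (fun x => loss x z))
    (hlip : ∀ z, IsLipschitzWith L (fun x => loss x z))
    (hsmooth : ∀ z, IsSmoothWith β (fun x => loss x z))
    -- a minimiser of the test risk
    (xstar : Model d) (hxstar : ∀ x, testRisk loss μ xstar ≤ testRisk loss μ x)
    -- data and sampled indices
    (D : Ω → Fin n → Fin m → Z) (K : Ω → ℕ → Fin n → Fin m) (hDK : IsSamplingModel Pr μ D K)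
    -- a minimiser of the empirical risk
    (Xstar : (Fin n → Fin m → Z) → Model d) (G : ℝ)
    (hXstar : ∀ᵐ ω ∂Pr, ∀ x, empiricalRisk loss (D ω) (Xstar (D ω)) ≤ empiricalRisk loss (D ω) x)
    (hG : ∀ᵐ ω ∂Pr, ‖Xstar (D ω)‖ ≤ G)
    -- step size and iterates started from zero
    (ρ η : ℝ) (hρ : 0 < ρ) (hη : η = 1 / (β + 1 / ρ)) (hηβ : η * β ≤ 2)
    (X : Ω → ℕ → Fin n → Model d)
    (hX : ∀ ω, X ω = distSGD loss P η (fun _ => 0) (D ω) (K ω))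
    -- gradient-noise bounds
    (σ κ : ℝ) (hσ : 0 < σ) (hκ : 0 < κ)
    (hvar : ∀ v k, ∫ ω, ‖lossGrad loss (X ω k v) (D ω v (K ω k v))
        - gradient (localRisk loss (D ω) v) (X ω k v)‖ ^ 2 ∂Pr ≤ σ ^ 2)
    (hdev : ∀ v k, ∫ ω, ‖lossGrad loss (X ω k v) (D ω v (K ω k v))
        - (1 / (n : ℝ)) • ∑ w, gradient (localRisk loss (D ω) w) (X ω k w)‖ ^ 2 ∂Pr ≤ κ ^ 2)
    (v : Fin n) (t : ℕ) (ht : 1 ≤ t) :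
    Integrable (fun ω => testRisk loss μ
        (ergodicAverage loss P η (fun _ => 0) (D ω) (K ω) t v)) Pr ∧
    (∫ ω, testRisk loss μ (ergodicAverage loss P η (fun _ => 0) (D ω) (K ω) t v) ∂Pr)
        - testRisk loss μ xstar ≤
      L ^ 2 / ((n : ℝ) * (m : ℝ) * (β + 1 / ρ)) * ((t : ℝ) + 1)
      + (ρ / 2 * σ ^ 2 + (β + 1 / ρ) * G ^ 2 / (2 * (t : ℝ))
        + 3 * κ / (β + 1 / ρ)
          * (Real.log (((t : ℝ) + 1) * √(n : ℝ)) / (1 - secondEigenvalueModulus P))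
          * (L + 3 / 2 * (β * (3 + β * ρ) * κ / (β + 1 / ρ))
            * (Real.log (((t : ℝ) + 1) * √(n : ℝ)) / (1 - secondEigenvalueModulus P)))) := by
  have h : IsRegularLoss L β loss := ⟨hL.le, hβ, hconvex, hlip, hsmooth⟩
  obtain ⟨ω₀⟩ := Measure.nonempty_of_neZero Pr
  -- an index into the samples exists, so there is at least one sample per node
  have hm : 0 < m := (K ω₀ 0 v).pos
  have hB : 0 < β + 1 / ρ := by positivity
  have hη0 : 0 < η := by rw [hη]; positivity
  have ht' : (1 : ℝ) ≤ t := by exact_mod_cast ht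
  have hgap' : 0 < 1 - secondEigenvalueModulus P := by linarith
  set Λ := Real.log (((t : ℝ) + 1) * √(n : ℝ)) / (1 - secondEigenvalueModulus P) with hΛ
  have hΛ0 : 0 < Λ := by
    refine div_pos (Real.log_pos ?_) hgap'
    have : 1 ≤ √(n : ℝ) := Real.one_le_sqrt.2 (by exact_mod_cast v.pos)
    nlinarith
  have hDKm : Measurable fun ω => (D ω, K ω) := hDK.measurable_D.prodMk hDK.measurable_K
  have hAm : Measurable fun ω => ergodicAverage loss P η (fun _ => 0) (D ω) (K ω) t v :=
    ((h.measurable_ergodicAverage (P := P) (η := η) hmeas t v).comp hDKm :)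
  have hlipA : ∀ ω, L * ‖ergodicAverage loss P η (fun _ => 0) (D ω) (K ω) t v - xstar‖ ≤
      L * (η * L * t + ‖xstar‖) := fun ω =>
    h.mul_norm_ergodicAverage_sub_le hP hη0.le _ _ ht v xstar
  have hrm : Measurable fun ω => testRisk loss μ
      (ergodicAverage loss P η (fun _ => 0) (D ω) (K ω) t v) - testRisk loss μ xstar :=
    (((h.measurable_testRisk hint).comp hAm).sub_const _ :)
  have htest := hrm.integrable_of_abs_le (Pr := Pr) fun ω =>
    (h.lipschitz_testRisk hint _ _).trans (hlipA ω)
  have hRm : Measurable fun ω => empiricalRisk loss (D ω)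
      (ergodicAverage loss P η (fun _ => 0) (D ω) (K ω) t v) - empiricalRisk loss (D ω) xstar :=
    (h.measurable_empiricalRisk hmeas hDK.measurable_D hAm).sub
      (h.measurable_empiricalRisk hmeas hDK.measurable_D measurable_const)
  have hemp := hRm.integrable_of_abs_le (Pr := Pr) fun ω =>
    (h.abs_empiricalRisk_sub_le v.pos hm _ _ _).trans (hlipA ω)
  have hint_r : Integrable (fun ω => testRisk loss μ
      (ergodicAverage loss P η (fun _ => 0) (D ω) (K ω) t v)) Pr := by
    simpa only [sub_add_cancel] using htest.fun_add (integrable_const (testRisk loss μ xstar))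
  refine ⟨hint_r, ?_⟩
  have hres : ∀ k, Integrable (fun ω => trajectoryResidual loss P L β ρ η (D ω) (K ω) v k) Pr :=
    fun k => by
      have hresm : Measurable fun ω => trajectoryResidual loss P L β ρ η (D ω) (K ω) v k :=
        ((h.measurable_trajectoryResidual (P := P) (η := η) hmeas ρ v k).comp hDKm :)
      exact hresm.integrable_of_abs_le fun ω => h.abs_trajectoryResidual_le hP hη0.le hρ _ _ v k
  simp only [hX] at hvar hdev
  have hnet : ∀ w, ∀ k ≤ t, ∫ ω, ‖distSGD loss P η (fun _ => 0) (D ω) (K ω) k w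
      - meanIterate loss P η (D ω) (K ω) k‖ ^ 2 ∂Pr ≤ (η * κ * (3 * Λ)) ^ 2 := fun w k hk =>
    hDK.integral_disagreement_sq_le h hmeas hP hη0.le hdev w k
      (sum_sum_abs_pow_sub_le hP hnormal hgap w ht hk)
  have hresidual : ∫ ω, 1 / (t : ℝ) * ∑ k ∈ Finset.range t,
      trajectoryResidual loss P L β ρ η (D ω) (K ω) v k ∂Pr ≤
      ρ / 2 * σ ^ 2 + β / 2 * (η * κ * (3 * Λ)) ^ 2 + L * (η * κ * (3 * Λ)) := by
    rw [integral_const_mul, integral_finsetSum _ fun k _ => hres k]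
    calc _ ≤ 1 / (t : ℝ) * ∑ _k ∈ Finset.range t,
          (ρ / 2 * σ ^ 2 + β / 2 * (η * κ * (3 * Λ)) ^ 2 + L * (η * κ * (3 * Λ))) := by
          gcongr with k hk
          have hk' := Finset.mem_range.1 hk
          exact hDK.integral_trajectoryResidual_le h hmeas hP hη0.le hρ (by positivity) v k
            (fun w => hvar w k) (fun w => hnet w k hk'.le) (hnet v (k + 1) hk')
      _ = _ := by rw [Finset.sum_const, Finset.card_range, nsmul_eq_mul]; field_simp
  have hgen := hDK.integral_generalisation_error_le h hmeas hint hm hP hη0.le hηβ ht v xstar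
  have hopt := hDK.integral_optimisation_error_le h hmeas hm hP hρ hη ht v xstar hXstar hG
  rw [integral_sub htest hemp] at hgen
  rw [integral_sub hemp ((integrable_finsetSum _ fun k _ => hres k).const_mul _)] at hopt
  rw [integral_sub hint_r (integrable_const _), integral_const, probReal_univ, one_smul] at hgen
  have e1 : 1 / ((n : ℝ) * m) * (L * (η * L * (t + 1))) =
      L ^ 2 / ((n : ℝ) * (m : ℝ) * (β + 1 / ρ)) * ((t : ℝ) + 1) := by
    have hn' : (n : ℝ) ≠ 0 := by have := v.pos; positivity
    have hm' : (m : ℝ) ≠ 0 := by positivity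
    rw [hη]
    generalize β + 1 / ρ = B at hB ⊢
    field_simp
  -- the quadratic disagreement term is smaller than the stated one by the factor `3 + β * ρ ≥ 1`
  have e2 : β / 2 * (η * κ * (3 * Λ)) ^ 2 + L * (η * κ * (3 * Λ)) ≤
      3 * κ / (β + 1 / ρ) * Λ * (L + 3 / 2 * (β * (3 + β * ρ) * κ / (β + 1 / ρ)) * Λ) := by
    have hηinv : ∀ x, x / (β + 1 / ρ) = η * x := fun x => by rw [hη]; ring
    rw [hηinv, hηinv]
    have : 0 ≤ 9 / 2 * (η * κ * Λ) ^ 2 * β * (2 + β * ρ) := by positivity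
    nlinarith
  linarith
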